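/- Let $\mathcal G=\langle V,V_0,V_1,E\rangle$ be a game graph with a finite non-empty set $V=V_0\uplus V_1$ of $n$ vertices, in which every vertex has at least one outgoing edge, and let $E^\ell\subseteq E\cap(V_1\times V)$ be a set of live edges. A play $\pi=v^0v^1\dots$ is fair if, for every $(v,v')\in E^\ell$, whenever $v$ occurs infinitely often in $\pi$, the edge $(v,v')$ is taken infinitely often. Player 0 wins the fair adversarial game for a winning condition $\varphi$ from $v$ if she has a strategy (with arbitrary memory) such that, against every strategy of Player 1, the resulting play from $v$ satisfies $\varphi$ or is not fair. For $S,T\subseteq V$ let $$\mathrm{Cpre}(S)=\{v\in V_0: E(v)\cap S\ne\emptyset\}\cup\{v\in V_1:E(v)\subseteq S\},$$ $$\mathrm{Apre}(S,T)=\mathrm{Cpre}(T)\cup\{v\in V_1: E^\ell(v)\cap T\neq\emptyset,\ E(v)\subseteq S\}.$$ Let $C_1,\dots,C_{2k}$ be pairwise disjoint (possibly empty) sets with union $V$. The parity condition is $$\bigwedge_{i=1}^{k}\Bigl(\Box\Diamond C_{2i-1}\to\bigvee_{j=i}^{k}\Box\Diamond C_{2j}\Bigr),$$ i.e. the maximal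 color seen infinitely often is even. Put $$Z^*=\nu Y_{2k}.\,\mu X_{2k-1}.\,\cdots\,\nu Y_2.\,\mu X_1.\ \bigcup_{j=1}^{k}\Bigl[\bigl(C_{2j}\cap\mathrm{Cpre}(Y_{2j})\bigr)\cup\bigl((C_1\cup\dots\cup C_{2j-1})\cap\mathrm{Apre}(Y_{2j},X_{2j-1})\bigr)\Bigr].$$ Then: 1. $Z^*$ is the winning region of Player 0 in the fair adversarial parity game. 2. The fixpoint algorithm computes $Z^*$ in $O(n^{k+1})$ symbolic steps; more precisely, in at most $c\,k^2\,n^{k+1}$ steps with an absolute constant $c$. Here the algorithm evaluates the nested fixpoints by iteration: each $\mu$-variable is started at $\emptyset$, and each $\nu$-variable is started at $V$ or, if available, at its last value for the same iteration counters of the enclosing $\mu$-variables. Iterations stop when the value is stable, and for a $\mu$-variable also when it equals $V$. Every union, intersection, predecessor operation, comparison of sets, and access to a stored set is one step. 3. A memoryless winning strategy for Player 0 can be extracted from the fixpoint: there is one memoryless strategy that wins from every $v\in Z^*$ and that moves from each $v\in V_0\cap Z^*$ to a successor in $Z^*$ of least rank. The rank of $v\in Z^*$ is the tuple $(i_{2k-1},i_{2k-3},\dots,i_1)$,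 ordered lexicographically, where $i_{2k-1}$ is the index of the first iterate of $X_{2k-1}$ (started at $\emptyset$, with $Y_{2k}$ at its final value) that contains $v$, and $i_{2k-3},\dots,i_1$ are determined in the same way in the evaluation of the inner fixpoints which produces that iterate. -/

import Mathlib

/-- A finite two-player game graph with live edges on the vertex set `V`.
Player 0 owns `V0`, Player 1 owns the complement of `V0`; live edges are edges that leave
vertices of Player 1. -/
structure LiveGame (V : Type*) where
  V0 : Set V
  E : V → V → Prop
  El : V → V → Prop
  live_owner : ∀ v w, El v w → v ∉ V0
  live_edge : ∀ v w, El v w → E v w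

namespace LiveGame

variable {V : Type*}

/-- The vertices of Player 1. -/
def V1 (G : LiveGame V) : Set V := G.V0ᶜ

/-! ### Strategies, plays, winning -/

/-- A strategy of Player 0. `ρ w v` is the vertex chosen after the history `w · v`; the
values at vertices `v` that the player does not own are irrelevant and never used. -/
def IsStrategy0 (G : LiveGame V) (ρ : List V → V → V) : Prop :=
  ∀ w, ∀ v ∈ G.V0, G.E v (ρ w v)

/-- A strategy of Player 1, with the same convention. -/
def IsStrategy1 (G : LiveGame V) (ρ : List V → V → V) : Prop :=
  ∀ w, ∀ v ∈ G.V1, G.E v (ρ w v)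

/-- A strategy of Player 0 is memoryless if its choice depends on the current vertex only. -/
def IsMemoryless0 (G : LiveGame V) (ρ : List V → V → V) : Prop :=
  ∀ w₁ w₂, ∀ v ∈ G.V0, ρ w₁ v = ρ w₂ v

/-- The history `π 0, …, π (i-1)` strictly before position `i`. -/
def history (π : ℕ → V) (i : ℕ) : List V := (List.range i).map π

/-- `π` is the play from `v` compliant with `ρ₀` and `ρ₁`. -/
def IsCompliantPlay (G : LiveGame V) (ρ₀ ρ₁ : List V → V → V) (v : V) (π : ℕ → V) : Prop :=
  π 0 = v ∧ ∀ i,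
    (π i ∈ G.V0 → π (i + 1) = ρ₀ (history π i) (π i)) ∧
    (π i ∈ G.V1 → π (i + 1) = ρ₁ (history π i) (π i))

/-- The strategy `ρ₀` of Player 0 wins from `v` for the winning condition `φ`. -/
def WinsFromWith (G : LiveGame V) (φ : Set (ℕ → V)) (ρ₀ : List V → V → V) (v : V) : Prop :=
  ∀ ρ₁, G.IsStrategy1 ρ₁ → ∀ π, G.IsCompliantPlay ρ₀ ρ₁ v π → π ∈ φ

/-- The winning region of Player 0 for the winning condition `φ`. -/
def winningRegion (G : LiveGame V) (φ : Set (ℕ → V)) : Set V :=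
  {v | ∃ ρ₀, G.IsStrategy0 ρ₀ ∧ G.WinsFromWith φ ρ₀ v}

/-- Strongly transition fair plays: for every live edge `(v, w)`, if `v` is visited infinitely
often, then the edge `(v, w)` is taken infinitely often. -/
def fairPlays (G : LiveGame V) : Set (ℕ → V) :=
  {π | ∀ v w, G.El v w →
    (∀ n, ∃ m ≥ n, π m = v) → ∀ n, ∃ m ≥ n, π m = v ∧ π (m + 1) = w}

/-- The winning condition "fair implies `φ`" of the fair adversarial game for `φ`. -/
def fairly (G : LiveGame V) (φ : Set (ℕ → V)) : Set (ℕ → V) :=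
  {π | π ∈ G.fairPlays → π ∈ φ}

/-! ### Set transformers -/

def pre0 (G : LiveGame V) (S : Set V) : Set V := {v | v ∈ G.V0 ∧ ∃ w, G.E v w ∧ w ∈ S}

def pre1 (G : LiveGame V) (S : Set V) : Set V := {v | v ∈ G.V1 ∧ ∀ w, G.E v w → w ∈ S}

def lpre (G : LiveGame V) (S : Set V) : Set V := {v | ∃ w, G.El v w ∧ w ∈ S}

def cpre (G : LiveGame V) (S : Set V) : Set V := G.pre0 S ∪ G.pre1 S

def apre (G : LiveGame V) (S T : Set V) : Set V := G.cpre T ∪ (G.lpre T ∩ G.pre1 S)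

end LiveGame

/-! ### Parity conditions -/

/-- `C 1, …, C (2k)` partition the vertex set (classes may be empty). -/
def IsParityColoring {V : Type*} (k : ℕ) (C : ℕ → Set V) : Prop :=
  (⋃ i ∈ Set.Icc 1 (2 * k), C i) = Set.univ ∧
  ∀ i ∈ Set.Icc 1 (2 * k), ∀ j ∈ Set.Icc 1 (2 * k), i ≠ j → C i ∩ C j = ∅

/-- `π` visits `A` infinitely often. -/
def InfOften {V : Type*} (π : ℕ → V) (A : Set V) : Prop := ∀ n, ∃ m ≥ n, π m ∈ A

/-- The (max-even) parity condition: whenever an odd color `2i-1` is seen infinitely often,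
some larger even color is seen infinitely often. -/
def parityCondition {V : Type*} (k : ℕ) (C : ℕ → Set V) : Set (ℕ → V) :=
  {π | ∀ i ∈ Set.Icc 1 k, InfOften π (C (2 * i - 1)) →
    ∃ j ∈ Set.Icc i k, InfOften π (C (2 * j))}

/-! ### The fixpoint -/

/-- Least fixpoint of a monotone set transformer. -/
def mu {V : Type*} (f : Set V → Set V) : Set V := sInf {S | f S ≤ S}

/-- Greatest fixpoint of a monotone set transformer. -/
def nu {V : Type*} (f : Set V → Set V) : Set V := sSup {S | S ≤ f S}

theorem mu_eq_lfp {V : Type*} (f : Set V →o Set V) : mu f = OrderHom.lfp f := rfl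

theorem nu_eq_gfp {V : Type*} (f : Set V →o Set V) : nu f = OrderHom.gfp f := rfl

/-- Replace the values of the variables `Y_{2j}` and `X_{2j-1}` in the valuation `W`
by `S` and `T`. -/
def assign {V : Type*} (W : ℕ → Set V) (j : ℕ) (S T : Set V) : ℕ → Set V :=
  Function.update (Function.update W (2 * j) S) (2 * j - 1) T

theorem assign_mono {V : Type*} {W W' : ℕ → Set V} (h : W ≤ W') (j : ℕ) (S T : Set V) :
    assign W j S T ≤ assign W' j S T := by
  intro i
  simp only [assign, Function.update_apply]
  split_ifs
  · exact le_rfl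
  · exact le_rfl
  · exact h i

namespace LiveGame

variable {V : Type*}

/-- The matrix of the fixpoint formula. In a valuation `W` the even entry `W (2j)` is the
value of `Y_{2j}` and the odd entry `W (2j-1)` is the value of `X_{2j-1}`. -/
def parityBody (G : LiveGame V) (k : ℕ) (C : ℕ → Set V) (W : ℕ → Set V) : Set V :=
  ⋃ j ∈ Set.Icc 1 k,
    (C (2 * j) ∩ G.cpre (W (2 * j))) ∪
    ((⋃ i ∈ Set.Icc 1 (2 * j - 1), C i) ∩ G.apre (W (2 * j)) (W (2 * j - 1)))

/-- `parityNest k C j W` is the value of `ν Y_{2j}. μ X_{2j-1}. … ν Y_2. μ X_1. parityBody`,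
where the variables of index `> 2j` have the values given by `W`. -/
def parityNest (G : LiveGame V) (k : ℕ) (C : ℕ → Set V) : ℕ → (ℕ → Set V) → Set V
  | 0, W => G.parityBody k C W
  | j + 1, W => nu fun S => mu fun T => G.parityNest k C j (assign W (j + 1) S T)

/-- `Z* = ν Y_{2k}. μ X_{2k-1}. … ν Y_2. μ X_1. parityBody` (a closed formula: the initial
valuation is irrelevant). -/
def parityFixpoint (G : LiveGame V) (k : ℕ) (C : ℕ → Set V) : Set V :=
  G.parityNest k C k (fun _ => ∅)

theorem cpre_mono (G : LiveGame V) {S T : Set V} (h : S ⊆ T) : G.cpre S ⊆ G.cpre T := by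
  rintro v (⟨h0, w, hw, hS⟩ | ⟨h1, hv⟩)
  · exact Or.inl ⟨h0, w, hw, h hS⟩
  · exact Or.inr ⟨h1, fun w hw => h (hv w hw)⟩

theorem apre_mono (G : LiveGame V) {S S' T T' : Set V} (h : S ⊆ S') (h' : T ⊆ T') :
    G.apre S T ⊆ G.apre S' T' := by
  rintro v (hv | ⟨⟨w, hw, hT⟩, h1, hv⟩)
  · exact Or.inl (G.cpre_mono h' hv)
  · exact Or.inr ⟨⟨w, hw, h' hT⟩, h1, fun w hw => h (hv w hw)⟩

/-- All functionals under `ν` and `μ` are monotone, so `nu` and `mu` are indeed fixpoints. -/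
theorem parityNest_mono (G : LiveGame V) (k : ℕ) (C : ℕ → Set V) (j : ℕ) :
    Monotone (G.parityNest k C j) := by
  induction j with
  | zero =>
    intro W W' h
    exact Set.iUnion₂_mono fun j _ => Set.union_subset_union
      (Set.inter_subset_inter_right _ (G.cpre_mono (h _)))
      (Set.inter_subset_inter_right _ (G.apre_mono (h _) (h _)))
  | succ j ih =>
    intro W W' h
    refine sSup_le_sSup fun S (hS : S ≤ _) => show S ≤ _ from le_trans hS ?_
    refine sInf_le_sInf fun T (hT : _ ≤ T) => show _ ≤ T from le_trans (ih ?_) hT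
    exact assign_mono h (j + 1) S T

/-! ### Ranks given by the iterates of the fixpoint -/

/-- The rank of a vertex of `parityNest k C j W`: the list `i_j, …, i_1`, where `i_j` is minimal
such that the vertex belongs to the iterate number `i_j + 1` for `X_{2j-1}` (iterate `0` is
empty, `Y_{2j}` has its final value), and `i_{j-1}, …, i_1` are found in the same way in the
evaluation of the inner fixpoints which produces this iterate from iterate number `i_j`. -/
noncomputable def parityRank (G : LiveGame V) (k : ℕ) (C : ℕ → Set V) :
    ℕ → (ℕ → Set V) → V → List ℕ
  | 0, _, _ => []
  | j + 1, W, v =>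
    let S := G.parityNest k C (j + 1) W
    let F : Set V → Set V := fun T => G.parityNest k C j (assign W (j + 1) S T)
    let i := sInf {i : ℕ | v ∈ F^[i + 1] ∅}
    i :: G.parityRank k C j (assign W (j + 1) S (F^[i] ∅)) v

/-- On the vertices of Player 0 in `Z*`, the strategy moves to a successor in `Z*` whose rank
is lexicographically least among all successors in `Z*` (vertices outside `Z*` count as having
infinite rank). -/
def IsRankMinimizing (G : LiveGame V) (k : ℕ) (C : ℕ → Set V) (ρ : List V → V → V) : Prop :=
  ∀ w, ∀ v ∈ G.V0 ∩ G.parityFixpoint k C,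
    ρ w v ∈ G.parityFixpoint k C ∧
    ∀ u ∈ G.parityFixpoint k C, G.E v u →
      G.parityRank k C k (fun _ => ∅) (ρ w v) ≤ G.parityRank k C k (fun _ => ∅) u

/-! ### The fixpoint algorithm, with its symbolic steps counted

The nested fixpoints are evaluated by iteration: a `μ`-variable starts at `∅`, a `ν`-variable is
warm-started with the last value it had for the same iteration counters of the enclosing
`μ`-variables. Every union, intersection, predecessor `pre0`, `pre1`, `lpre`, comparison of two
sets, and every access to the stored sets, is one symbolic step. -/

/-- The memory of the algorithm: the number of symbolic steps made so far, and the stored values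
of the `ν`-variables. The key is the list of the current iteration counters of the enclosing
`μ`-variables (its length tells which `ν`-variable is meant). -/
structure Mem (V : Type*) where
  steps : ℕ
  stored : List ℕ → Set V

/-- Account for `n` symbolic steps. -/
def Mem.tick (n : ℕ) (s : Mem V) : Mem V := { s with steps := s.steps + n }

/-- Store the set `S` under the key `δ`. -/
def Mem.store (δ : List ℕ) (S : Set V) (s : Mem V) : Mem V :=
  { s with stored := Function.update s.stored δ S }

/-- A set expression evaluated symbolically: its value and the number of symbolic steps. -/
abbrev Counted (V : Type*) := Set V × ℕ

namespace Counted

/-- A set that is already available. -/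
def val (S : Set V) : Counted V := (S, 0)

def union (a b : Counted V) : Counted V := (a.1 ∪ b.1, a.2 + b.2 + 1)

def inter (a b : Counted V) : Counted V := (a.1 ∩ b.1, a.2 + b.2 + 1)

def pre0 (G : LiveGame V) (a : Counted V) : Counted V := (G.pre0 a.1, a.2 + 1)

def pre1 (G : LiveGame V) (a : Counted V) : Counted V := (G.pre1 a.1, a.2 + 1)

def lpre (G : LiveGame V) (a : Counted V) : Counted V := (G.lpre a.1, a.2 + 1)

def cpre (G : LiveGame V) (S : Set V) : Counted V :=
  union (pre0 G (val S)) (pre1 G (val S))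

def apre (G : LiveGame V) (S T : Set V) : Counted V :=
  union (cpre G T) (inter (lpre G (val T)) (pre1 G (val S)))

/-- The matrix of the formula, row by row: the first component is the union of the rows
`1, …, j`, the second one is the set `C 1 ∪ … ∪ C (2j)`, which the next row needs; the steps
spent on both are recorded in the first component. -/
def body (G : LiveGame V) (C : ℕ → Set V) (W : ℕ → Set V) : ℕ → Counted V × Set V
  | 0 => (val ∅, ∅)
  | j + 1 =>
    let r := body G C W j
    let lower := union (val r.2) (val (C (2 * j + 1)))
    let all := union (val lower.1) (val (C (2 * j + 2)))
    let row := union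
      (inter (val (C (2 * j + 2))) (cpre G (W (2 * j + 2))))
      (inter lower (apre G (W (2 * j + 2)) (W (2 * j + 1))))
    let res := union r.1 row
    ((res.1, res.2 + all.2), all.1)

end Counted

open Classical in
/-- The iteration for a `μ`-variable whose current value is `T` and whose counter is `i`.
`f i T` evaluates the formula below. The iteration stops when the value is stable or is the
set of all vertices. -/
noncomputable def muLoop [Finite V] (f : ℕ → Set V → Mem V → Set V × Mem V)
    (i : ℕ) (T : Set V) (s : Mem V) : Set V × Mem V :=
  let r := f i T s
  let T' := T ∪ r.1
  let s' := r.2.tick 3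
  if _h : T' = T then (T, s')
  else if T' = Set.univ then (T', s')
  else muLoop f (i + 1) T' s'
termination_by Tᶜ.ncard
decreasing_by
  exact Set.ncard_lt_ncard (compl_lt_compl_iff_lt.2
    (Set.subset_union_left.ssubset_of_ne (Ne.symm _h)))

open Classical in
/-- The iteration for a `ν`-variable whose current value is `S`. `g S` evaluates the formula
below. The iteration stops when the value is stable. -/
noncomputable def nuLoop [Finite V] (g : Set V → Mem V → Set V × Mem V)
    (S : Set V) (s : Mem V) : Set V × Mem V :=
  let r := g S s
  let S' := S ∩ r.1
  let s' := r.2.tick 2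
  if _h : S' = S then (S, s')
  else nuLoop g S' s'
termination_by S.ncard
decreasing_by
  exact Set.ncard_lt_ncard (Set.inter_subset_left.ssubset_of_ne _h)

/-- Evaluation of `ν Y_{2j}. μ X_{2j-1}. … ν Y_2. μ X_1. parityBody` in the valuation `W`; the
key `δ` lists the counters of the enclosing `μ`-variables. -/
noncomputable def paritySolve [Finite V] (G : LiveGame V) (k : ℕ) (C : ℕ → Set V) :
    ℕ → List ℕ → (ℕ → Set V) → Mem V → Set V × Mem V
  | 0, _, W, s =>
    let b := (Counted.body G C W k).1
    (b.1, s.tick b.2)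
  | j + 1, δ, W, s =>
    let r := nuLoop
      (fun S => muLoop
        (fun i T => paritySolve G k C j (i :: δ) (assign W (j + 1) S T)) 0 ∅)
      (s.stored δ) (s.tick 1)
    (r.1, (r.2.store δ r.1).tick 1)

/-- The whole run. Initially every stored set is the set of all vertices. -/
noncomputable def parityRun [Finite V] (G : LiveGame V) (k : ℕ) (C : ℕ → Set V) :
    Set V × Mem V :=
  G.paritySolve k C k [] (fun _ => ∅) ⟨0, fun _ => Set.univ⟩

/-- The set that the fixpoint algorithm returns. -/
noncomputable def parityOutput [Finite V] (G : LiveGame V) (k : ℕ) (C : ℕ → Set V) : Set V :=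
  (G.parityRun k C).1

/-- The number of symbolic steps that the fixpoint algorithm makes. -/
noncomputable def paritySteps [Finite V] (G : LiveGame V) (k : ℕ) (C : ℕ → Set V) : ℕ :=
  (G.parityRun k C).2.steps

end LiveGame

/-! ### Fixpoints and their iterates -/

section Fixpoints

variable {V : Type*} {f : Set V → Set V}

/-! Membership in `Z*` unfolds into one valuation: every `Y` has its final value, every `X` the last
iterate that misses `v` (`exists_valuation_of_mem`). The row `j` of the matrix that holds at `v`
then says how the rank changes. No move raises the entries for the variables above `X_{2j-1}`.
Moreover the color is `2j`, or every move lowers the prefix ending with the entry for `X_{2j-1}`, or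
some live edge does (`exists_row_of_mem`).

In a fair play that violates parity, let `J` be the largest row on the set of vertices visited
infinitely often. Color `2J` is seen only finitely often, so each limit vertex of row `J` has a
limit vertex with a smaller prefix, reached by the play itself or by a live edge; limit vertices of
smaller rows never raise that prefix. A value with these properties is constant on the limit set
(`not_lt_of_infOften`), a contradiction.

Outside `Z*` the argument is dual, with coranks counting the iterates of the `Y` variables. Player 1
rotates between a move chosen by corank and, where needed, all live moves
(`exists_moves_of_notMem`). At the largest level of the limit set only the odd color of that level
survives, larger even colors are impossible, and rotation makes the play fair.

The algorithm is correct because a stored set stays an upper bound as the enclosing `Y` values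
shrink (`WarmStart`). Its cost is amortized: an iteration of a `ν`-variable that is not the last
removes a vertex from a stored set, and that vertex pays for the iteration (`potential`). -/

theorem map_mu (hf : Monotone f) : f (mu f) = mu f := OrderHom.map_lfp ⟨f, hf⟩

theorem map_nu (hf : Monotone f) : f (nu f) = nu f := OrderHom.map_gfp ⟨f, hf⟩

theorem mu_le {S : Set V} (h : f S ≤ S) : mu f ≤ S := sInf_le h

theorem le_nu {S : Set V} (h : S ≤ f S) : S ≤ nu f := le_sSup h

theorem mu_mono {g : Set V → Set V} (h : f ≤ g) : mu f ≤ mu g :=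
  sInf_le_sInf fun T hT => le_trans (h T) hT

theorem iterate_le_mu (hf : Monotone f) (i : ℕ) : f^[i] ∅ ≤ mu f := by
  induction i with
  | zero => exact Set.empty_subset _
  | succ i ih =>
    rw [Function.iterate_succ_apply', ← map_mu hf]
    exact hf ih

theorem nu_le_iterate (hf : Monotone f) (i : ℕ) : nu f ≤ f^[i] Set.univ := by
  induction i with
  | zero => exact Set.subset_univ _
  | succ i ih =>
    rw [Function.iterate_succ_apply', ← map_nu hf]
    exact hf ih

theorem iterate_empty_mono (hf : Monotone f) : Monotone fun i => f^[i] ∅ :=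
  hf.monotone_iterate_of_le_map (Set.empty_subset _)

theorem iterate_univ_antitone (hf : Monotone f) : Antitone fun i => f^[i] Set.univ :=
  hf.antitone_iterate_of_map_le (Set.subset_univ _)

theorem exists_mem_iterate_of_mem_mu [Finite V] (hf : Monotone f) {v : V} (hv : v ∈ mu f) :
    ∃ i, v ∈ f^[i + 1] ∅ := by
  obtain ⟨n, hn⟩ := WellFoundedGT.monotone_chain_condition ⟨_, iterate_empty_mono hf⟩
  have h : f^[n] ∅ = f^[n + 1] ∅ := hn (n + 1) n.le_succ
  refine ⟨n, h ▸ mu_le (f := f) ?_ hv⟩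
  rw [← Function.iterate_succ_apply' f, ← h]

theorem exists_notMem_iterate_of_notMem_nu [Finite V] (hf : Monotone f) {v : V}
    (hv : v ∉ nu f) : ∃ i, v ∉ f^[i + 1] Set.univ := by
  obtain ⟨n, hn⟩ := WellFoundedGT.monotone_chain_condition
    (⟨_, iterate_univ_antitone hf⟩ : ℕ →o (Set V)ᵒᵈ)
  have h : f^[n] Set.univ = f^[n + 1] Set.univ := hn (n + 1) n.le_succ
  refine ⟨n, fun hv' => hv (le_nu (f := f) (S := f^[n] Set.univ) ?_ (h ▸ hv'))⟩
  rw [← Function.iterate_succ_apply' f, ← h]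

theorem iterate_mono_of_le {g : Set V → Set V} (hg : Monotone g) (h : f ≤ g) (i : ℕ)
    (S : Set V) : f^[i] S ≤ g^[i] S := by
  induction i with
  | zero => exact le_rfl
  | succ i ih =>
    rw [Function.iterate_succ_apply', Function.iterate_succ_apply']
    exact (h _).trans (hg ih)

end Fixpoints

/-! ### Monotonicity and lookup for updated valuations. -/

section Assign

variable {V : Type*} (W : ℕ → Set V) (j : ℕ) (S T : Set V)

theorem assign_le_assign {W W' : ℕ → Set V} {S S' T T' : Set V} (hW : W ≤ W') (hS : S ≤ S')
    (hT : T ≤ T') : assign W j S T ≤ assign W' j S' T' := by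
  intro i
  simp only [assign, Function.update_apply]
  split_ifs
  · exact hT
  · exact hS
  · exact hW i

theorem assign_even : assign W (j + 1) S T (2 * (j + 1)) = S := by
  simp only [assign, Function.update_apply]
  rw [if_neg (by omega), if_pos trivial]

theorem assign_odd : assign W (j + 1) S T (2 * (j + 1) - 1) = T := by
  simp only [assign, Function.update_apply, if_true]

theorem assign_of_lt {i : ℕ} (hi : 2 * (j + 1) < i) : assign W (j + 1) S T i = W i := by
  simp only [assign, Function.update_apply]
  rw [if_neg (by omega), if_neg (by omega)]

end Assign

/-! ### The two functionals at one level of the nesting, and the matrix. -/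

namespace LiveGame

variable {V : Type*} (G : LiveGame V) (k : ℕ) (C : ℕ → Set V)

/-- The functional under `μ X_{2j+1}` when `Y_{2j+2}` has the value `S`. -/
def parityInner (j : ℕ) (W : ℕ → Set V) (S T : Set V) : Set V :=
  G.parityNest k C j (assign W (j + 1) S T)

/-- The functional under `ν Y_{2j+2}`. -/
def parityOuter (j : ℕ) (W : ℕ → Set V) (S : Set V) : Set V :=
  mu (G.parityInner k C j W S)

variable {G k C}

theorem parityInner_le {j : ℕ} {W W' : ℕ → Set V} {S S' T T' : Set V} (hW : W ≤ W')
    (hS : S ≤ S') (hT : T ≤ T') : G.parityInner k C j W S T ≤ G.parityInner k C j W' S' T' :=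
  G.parityNest_mono k C j (assign_le_assign _ hW hS hT)

theorem parityInner_mono (j : ℕ) (W : ℕ → Set V) (S : Set V) :
    Monotone (G.parityInner k C j W S) := fun _ _ h => parityInner_le le_rfl le_rfl h

theorem parityOuter_mono (j : ℕ) (W : ℕ → Set V) : Monotone (G.parityOuter k C j W) :=
  fun _ _ h => mu_mono fun _ => parityInner_le le_rfl h le_rfl

variable (G k C)

/-! ### The value of the matrix and the number of steps for it -/

theorem body_snd (W : ℕ → Set V) (j : ℕ) :
    (Counted.body G C W j).2 = ⋃ i ∈ Set.Icc 1 (2 * j), C i := by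
  induction j with
  | zero =>
    ext v
    simp only [Counted.body, Set.mem_empty_iff_false, Set.mem_iUnion, Set.mem_Icc, false_iff]
    rintro ⟨i, hi, -⟩
    omega
  | succ j ih =>
    have h : (Counted.body G C W (j + 1)).2 =
        (Counted.body G C W j).2 ∪ C (2 * j + 1) ∪ C (2 * j + 2) := rfl
    rw [h, ih]
    ext v
    simp only [Set.mem_union, Set.mem_iUnion, Set.mem_Icc, exists_prop]
    constructor
    · rintro ((⟨i, hi, hv⟩ | hv) | hv)
      exacts [⟨i, by omega, hv⟩, ⟨_, by omega, hv⟩, ⟨_, by omega, hv⟩]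
    · rintro ⟨i, hi, hv⟩
      obtain hi' | rfl | rfl : i ≤ 2 * j ∨ i = 2 * j + 1 ∨ i = 2 * j + 2 := by omega
      exacts [.inl (.inl ⟨i, ⟨hi.1, hi'⟩, hv⟩), .inl (.inr hv), .inr hv]

theorem body_fst_fst (W : ℕ → Set V) (j : ℕ) :
    (Counted.body G C W j).1.1 = G.parityBody j C W := by
  induction j with
  | zero =>
    ext v
    simp only [Counted.body, Counted.val, parityBody, Set.mem_empty_iff_false, Set.mem_iUnion,
      Set.mem_Icc, false_iff]
    rintro ⟨i, hi, -⟩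
    omega
  | succ j ih =>
    have h : (Counted.body G C W (j + 1)).1.1 = (Counted.body G C W j).1.1 ∪
        ((C (2 * j + 2) ∩ G.cpre (W (2 * j + 2))) ∪
          (((Counted.body G C W j).2 ∪ C (2 * j + 1)) ∩
            G.apre (W (2 * j + 2)) (W (2 * j + 1)))) := rfl
    have hl : (Counted.body G C W j).2 ∪ C (2 * j + 1) =
        ⋃ i ∈ Set.Icc 1 (2 * (j + 1) - 1), C i := by
      rw [body_snd]
      ext v
      simp only [Set.mem_union, Set.mem_iUnion, Set.mem_Icc, exists_prop]
      constructor
      · rintro (⟨i, hi, hv⟩ | hv)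
        exacts [⟨i, by omega, hv⟩, ⟨_, by omega, hv⟩]
      · rintro ⟨i, hi, hv⟩
        obtain hi' | rfl : i ≤ 2 * j ∨ i = 2 * j + 1 := by omega
        exacts [.inl ⟨i, ⟨hi.1, hi'⟩, hv⟩, .inr hv]
    rw [h, ih, hl, parityBody, parityBody,
      show Set.Icc 1 (j + 1) = Set.Icc 1 j ∪ {j + 1} by
        ext i; simp only [Set.mem_Icc, Set.mem_union, Set.mem_singleton_iff]; omega,
      Set.biUnion_union, Set.biUnion_singleton]
    rfl

theorem body_fst_snd (W : ℕ → Set V) (j : ℕ) : (Counted.body G C W j).1.2 = 16 * j := by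
  induction j with
  | zero => rfl
  | succ j ih =>
    have h : (Counted.body G C W (j + 1)).1.2 = (Counted.body G C W j).1.2 + 16 := rfl
    rw [h, ih]
    ring

/-! ### Correctness of the algorithm -/

/-- The stored sets below the key `δ` are large enough to start the evaluation of
`parityNest k C j W` from them. -/
def WarmStart : ℕ → List ℕ → (ℕ → Set V) → (List ℕ → Set V) → Prop
  | 0, _, _, _ => True
  | j + 1, δ, W, st => G.parityNest k C (j + 1) W ≤ st δ ∧
    ∀ i, WarmStart j (i :: δ) (assign W (j + 1) (st δ) ((G.parityInner k C j W (st δ))^[i] ∅)) st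

variable {G k C}

/-- A smaller valuation gives smaller iterates with the same counters, so sets stored under these
counters remain upper bounds. This is what makes reuse sound when an enclosing `Y` shrinks. -/
theorem WarmStart.antitone {j : ℕ} {δ : List ℕ} {W W' : ℕ → Set V} {st : List ℕ → Set V}
    (h : G.WarmStart k C j δ W' st) (hW : W ≤ W') : G.WarmStart k C j δ W st := by
  induction j generalizing δ W W' with
  | zero => trivial
  | succ j ih =>
    refine ⟨(G.parityNest_mono k C _ hW).trans h.1, fun i => ih (h.2 i) ?_⟩
    exact assign_le_assign _ hW le_rfl
      (iterate_mono_of_le (parityInner_mono _ _ _) (fun _ => parityInner_le hW le_rfl le_rfl) _ _)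

theorem WarmStart.congr {j : ℕ} {δ : List ℕ} {W : ℕ → Set V} {st st' : List ℕ → Set V}
    (h : G.WarmStart k C j δ W st) (hst : ∀ κ, δ <:+ κ → st' κ = st κ) :
    G.WarmStart k C j δ W st' := by
  induction j generalizing δ W with
  | zero => trivial
  | succ j ih =>
    have hδ := hst δ List.suffix_rfl
    refine ⟨hδ ▸ h.1, fun i => ?_⟩
    rw [hδ]
    exact ih (h.2 i) fun κ hκ => hst κ ((List.suffix_cons i δ).trans hκ)

theorem warmStart_univ (j : ℕ) (δ : List ℕ) (W : ℕ → Set V) :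
    G.WarmStart k C j δ W fun _ => Set.univ := by
  induction j generalizing δ W with
  | zero => trivial
  | succ j ih => exact ⟨Set.subset_univ _, fun i => ih _ _⟩

/-- Keys grow at the head, so different counters over the same `δ` own disjoint families of keys: an
evaluation for one counter cannot disturb what is stored for another. -/
theorem not_cons_suffix_of_ne {i i' : ℕ} {δ κ : List ℕ} (hi : i' ≠ i) (h : i' :: δ <:+ κ) :
    ¬ i :: δ <:+ κ := by
  intro h'
  have := (List.suffix_of_suffix_length_le h h' (by simp)).eq_of_length (by simp)
  simp_all

theorem not_cons_suffix_self (i : ℕ) (δ : List ℕ) : ¬ i :: δ <:+ δ := fun h => by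
  have := h.length_le
  simp at this

/-! ### The potential function and its bounds. -/

/-- The amortized number of steps of an evaluation at level `j`, for `n` vertices. -/
def amortizedSteps (n k : ℕ) : ℕ → ℕ
  | 0 => 16 * k
  -- The 4 is one read, one write, and the intersection and comparison of the last `ν`-iteration;
  -- the 3 is the union and the two comparisons of each of at most `n` `μ`-iterations.
  | j + 1 => 4 + n * (3 + amortizedSteps n k j)

/-- The potential of the stored sets below the key `δ`: every vertex of a stored set pays for
one iteration of the `ν`-variable. -/
noncomputable def potential (n k : ℕ) : ℕ → List ℕ → (List ℕ → Set V) → ℕ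
  | 0, _, _ => 0
  | j + 1, δ, st => (2 + n * (3 + amortizedSteps n k j)) * (st δ).ncard +
      ∑ i ∈ Finset.range n, potential n k j (i :: δ) st

theorem potential_congr (n k j : ℕ) (δ : List ℕ) {st st' : List ℕ → Set V}
    (hst : ∀ κ, δ <:+ κ → st' κ = st κ) : potential n k j δ st' = potential n k j δ st := by
  induction j generalizing δ with
  | zero => rfl
  | succ j ih =>
    rw [potential, potential, hst δ List.suffix_rfl, Finset.sum_congr rfl fun i _ => ih (i :: δ) ?_]
    exact fun κ hκ => hst κ ((List.suffix_cons i δ).trans hκ)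

theorem potential_update (n k j : ℕ) (δ : List ℕ) (st : List ℕ → Set V) (S : Set V) :
    potential n k (j + 1) δ (Function.update st δ S) =
      (2 + n * (3 + amortizedSteps n k j)) * S.ncard +
        ∑ i ∈ Finset.range n, potential n k j (i :: δ) st := by
  rw [potential, Function.update_self]
  congr 1
  refine Finset.sum_congr rfl fun i _ => potential_congr n k j (i :: δ) fun κ hκ => ?_
  refine Function.update_of_ne ?_ _ _
  rintro rfl
  exact not_cons_suffix_self _ _ hκ

theorem amortizedSteps_le {n : ℕ} (hn : 1 ≤ n) (k j : ℕ) :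
    amortizedSteps n k j ≤ n ^ j * (16 * k + 7 * j) := by
  induction j with
  | zero => simp [amortizedSteps]
  | succ j ih =>
    have h1 : 1 ≤ n ^ j := Nat.one_le_pow _ _ hn
    calc amortizedSteps n k (j + 1) ≤ 4 * n + n * (3 + amortizedSteps n k j) := by
          rw [amortizedSteps]; omega
      _ = n * (7 + amortizedSteps n k j) := by ring
      _ ≤ n * (7 * n ^ j + n ^ j * (16 * k + 7 * j)) := by gcongr; omega
      _ = n ^ (j + 1) * (16 * k + 7 * (j + 1)) := by ring

theorem potential_univ_le {n : ℕ} (hn : 1 ≤ n) (hV : Nat.card V = n) (k j : ℕ) (δ : List ℕ) :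
    potential n k j δ (fun _ => (Set.univ : Set V)) ≤ j * n ^ (j + 1) * (16 * k + 7 * j) := by
  induction j generalizing δ with
  | zero => simp [potential]
  | succ j ih =>
    have h1 := amortizedSteps_le hn k (j + 1)
    rw [amortizedSteps] at h1
    calc potential n k (j + 1) δ (fun _ => (Set.univ : Set V))
        ≤ (2 + n * (3 + amortizedSteps n k j)) * n +
          ∑ i ∈ Finset.range n, j * n ^ (j + 1) * (16 * k + 7 * j) := by
          rw [potential, Set.ncard_univ, hV]
          gcongr
          exact ih _
      _ ≤ n ^ (j + 1) * (16 * k + 7 * (j + 1)) * n +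
          n * (j * n ^ (j + 1) * (16 * k + 7 * (j + 1))) := by
          rw [Finset.sum_const, Finset.card_range, smul_eq_mul]
          gcongr <;> omega
      _ = (j + 1) * n ^ (j + 1 + 1) * (16 * k + 7 * (j + 1)) := by ring

/-! ### Invariants of the two loops. -/

section Loops

variable [Finite V]

theorem muLoop_rel {R : Mem V → Mem V → Prop} {f : ℕ → Set V → Mem V → Set V × Mem V}
    (trans : ∀ a b c, R a b → R b c → R a c) (tick : ∀ n s, R s (s.tick n))
    (hf : ∀ i T s, R s (f i T s).2) (i : ℕ) (T : Set V) (s : Mem V) :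
    R s (muLoop f i T s).2 := by
  induction i, T, s using muLoop.induct f with
  | case1 i T s r T' h =>
    rw [muLoop, dif_pos h]
    exact trans _ _ _ (hf i T s) (tick _ _)
  | case2 i T s r T' h h' =>
    rw [muLoop, dif_neg h, if_pos h']
    exact trans _ _ _ (hf i T s) (tick _ _)
  | case3 i T s r T' s' h h' ih =>
    rw [muLoop, dif_neg h, if_neg h']
    exact trans _ _ _ (trans _ _ _ (hf i T s) (tick _ _)) ih

theorem nuLoop_rel {R : Mem V → Mem V → Prop} {g : Set V → Mem V → Set V × Mem V}
    (trans : ∀ a b c, R a b → R b c → R a c) (tick : ∀ n s, R s (s.tick n))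
    (hg : ∀ S s, R s (g S s).2) (S : Set V) (s : Mem V) :
    R s (nuLoop g S s).2 := by
  induction S, s using nuLoop.induct g with
  | case1 S s r S' h =>
    rw [nuLoop, dif_pos h]
    exact trans _ _ _ (hg S s) (tick _ _)
  | case2 S s r S' s' h ih =>
    rw [nuLoop, dif_neg h]
    exact trans _ _ _ (trans _ _ _ (hg S s) (tick _ _)) ih

/-- Only keys that extend `δ` are written. -/
theorem paritySolve_stored (j : ℕ) (δ : List ℕ) (W : ℕ → Set V) (s : Mem V) (κ : List ℕ)
    (hκ : ¬ δ <:+ κ) : (G.paritySolve k C j δ W s).2.stored κ = s.stored κ := by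
  induction j generalizing δ W s with
  | zero => rfl
  | succ j ih =>
    rw [paritySolve]
    have hne : κ ≠ δ := fun h => hκ (h ▸ List.suffix_rfl)
    simp only [Mem.tick, Mem.store, Function.update_of_ne hne]
    refine nuLoop_rel (R := fun s s' => s'.stored κ = s.stored κ) (fun a b c h h' => h'.trans h)
      (fun _ _ => rfl) (fun S s => ?_) _ _
    exact muLoop_rel (R := fun s s' => s'.stored κ = s.stored κ) (fun a b c h h' => h'.trans h)
      (fun _ _ => rfl) (fun i T s => ih _ _ _ fun h => hκ ((List.suffix_cons i δ).trans h)) _ _ _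

/-- The union with the old value changes nothing, since the iterates increase; so the loop value
with counter `i` is exactly the `i`-th iterate. Both stopping rules give the least fixpoint: a
stable iterate is a fixpoint, and an iterate equal to the whole set leaves no room above it. -/
theorem muLoop_eq_mu {F : Set V → Set V} (hF : Monotone F) {P : Mem V → Prop}
    {f : ℕ → Set V → Mem V → Set V × Mem V} (tick : ∀ n s, P s → P (s.tick n))
    (hf : ∀ i s, P s → (f i (F^[i] ∅) s).1 = F (F^[i] ∅) ∧ P (f i (F^[i] ∅) s).2)
    (i : ℕ) (T : Set V) (s : Mem V) (hT : T = F^[i] ∅) (hs : P s) :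
    (muLoop f i T s).1 = mu F ∧ P (muLoop f i T s).2 := by
  induction i, T, s using muLoop.induct f with
  | case1 i T s r T' h =>
    subst hT
    rw [muLoop, dif_pos h]
    refine ⟨le_antisymm (iterate_le_mu hF i) (mu_le ?_), tick _ _ (hf i s hs).2⟩
    rw [← (hf i s hs).1]
    exact Set.union_eq_left.1 h
  | case2 i T s r T' h h' =>
    subst hT
    have hT' : T' = F^[i + 1] ∅ := by
      rw [Function.iterate_succ_apply', ← (hf i s hs).1]
      refine Set.union_eq_right.2 ?_
      rw [(hf i s hs).1, ← Function.iterate_succ_apply' F]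
      exact iterate_empty_mono hF i.le_succ
    rw [muLoop, dif_neg h, if_pos h']
    refine ⟨le_antisymm (hT'.trans_le (iterate_le_mu hF _)) ?_, tick _ _ (hf i s hs).2⟩
    change mu F ≤ T'
    rw [h']
    exact Set.subset_univ _
  | case3 i T s r T' s' h h' ih =>
    subst hT
    have hT' : T' = F^[i + 1] ∅ := by
      rw [Function.iterate_succ_apply', ← (hf i s hs).1]
      refine Set.union_eq_right.2 ?_
      rw [(hf i s hs).1, ← Function.iterate_succ_apply' F]
      exact iterate_empty_mono hF i.le_succ
    rw [muLoop, dif_neg h, if_neg h']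
    exact ih hT' (tick _ _ (hf i s hs).2)

/-- The start is only assumed to lie above the greatest fixpoint. Intersecting keeps it there, and
stability means `S ≤ F S`, which puts `S` below the fixpoint as well. -/
theorem nuLoop_eq_nu {F : Set V → Set V} (hF : Monotone F) {P : Set V → Mem V → Prop}
    {g : Set V → Mem V → Set V × Mem V} (tick : ∀ n S s, P S s → P S (s.tick n))
    (anti : ∀ S S' s, S' ≤ S → P S s → P S' s)
    (hg : ∀ S s, P S s → (g S s).1 = F S ∧ P S (g S s).2)
    (S : Set V) (s : Mem V) (hS : nu F ≤ S) (hs : P S s) :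
    (nuLoop g S s).1 = nu F ∧ P (nu F) (nuLoop g S s).2 := by
  induction S, s using nuLoop.induct g with
  | case1 S s r S' h =>
    have hSF : S = nu F := by
      refine le_antisymm (le_nu ?_) hS
      rw [← (hg S s hs).1]
      exact Set.inter_eq_left.1 h
    rw [nuLoop, dif_pos h]
    exact ⟨hSF, hSF ▸ tick _ _ _ (hg S s hs).2⟩
  | case2 S s r S' s' h ih =>
    rw [nuLoop, dif_neg h]
    refine ih (Set.subset_inter hS ?_) (anti _ _ _ Set.inter_subset_left (tick _ _ _ (hg S s hs).2))
    rw [(hg S s hs).1, ← map_nu hF]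
    exact hF hS

theorem paritySolve_spec (j : ℕ) (δ : List ℕ) (W : ℕ → Set V) (s : Mem V)
    (hs : G.WarmStart k C j δ W s.stored) :
    (G.paritySolve k C j δ W s).1 = G.parityNest k C j W ∧
      G.WarmStart k C j δ W (G.paritySolve k C j δ W s).2.stored := by
  induction j generalizing δ W s with
  | zero => exact ⟨body_fst_fst G C W k, trivial⟩
  | succ j ih =>
    let P : Set V → Mem V → Prop := fun S s => ∀ i, G.WarmStart k C j (i :: δ)
      (assign W (j + 1) S ((G.parityInner k C j W S)^[i] ∅)) s.stored
    have key := nuLoop_eq_nu (parityOuter_mono (G := G) (k := k) (C := C) j W) (P := P)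
      (g := fun S => muLoop
        (fun i T => paritySolve G k C j (i :: δ) (assign W (j + 1) S T)) 0 ∅)
      (fun _ _ _ h => h)
      (fun S S' s hS h i => (h i).antitone (assign_le_assign _ le_rfl hS
        (iterate_mono_of_le (parityInner_mono _ _ _)
          (fun _ => parityInner_le le_rfl hS le_rfl) _ _)))
      (fun S s h => muLoop_eq_mu (parityInner_mono j W S) (P := P S) (fun _ _ h => h)
        (fun i s h => ⟨(ih _ _ _ (h i)).1, fun i' => by
          -- The run for counter `i` restores its own invariant by induction and does not touch the
          -- keys of its siblings.
          by_cases hi : i' = i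
          · subst hi
            exact (ih _ _ _ (h i')).2
          · exact (h i').congr fun κ hκ =>
              paritySolve_stored _ _ _ _ _ (not_cons_suffix_of_ne hi hκ)⟩) 0 ∅ s rfl h)
      (s.stored δ) (s.tick 1) hs.1 hs.2
    rw [paritySolve]
    refine ⟨key.1, ?_⟩
    change G.WarmStart k C (j + 1) δ W (Function.update _ δ _)
    rw [WarmStart, Function.update_self, key.1]
    refine ⟨le_rfl, fun i => (key.2 i).congr fun κ hκ => Function.update_of_ne ?_ _ _⟩
    rintro rfl
    exact not_cons_suffix_self _ _ hκ

variable (G k C) in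
theorem parityOutput_eq : G.parityOutput k C = G.parityFixpoint k C :=
  (paritySolve_spec k [] _ _ (warmStart_univ _ _ _)).1

/-! ### The number of symbolic steps -/

/-- The counter is at most the size of the current set, which is not all of `V`, so only counters
below `Nat.card V` occur. Stopping at the full set thus saves a confirming iteration and keeps the
factor at `n` instead of `n + 1`. A call with counter `i` changes only the summand `φ i`. -/
theorem muLoop_steps {φ : ℕ → (List ℕ → Set V) → ℕ} {a : ℕ}
    {f : ℕ → Set V → Mem V → Set V × Mem V}
    (hf : ∀ i T s, (f i T s).2.steps + φ i (f i T s).2.stored ≤ s.steps + φ i s.stored + a)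
    (hne : ∀ i i' T s, i' ≠ i → φ i' (f i T s).2.stored = φ i' s.stored)
    (i : ℕ) (T : Set V) (s : Mem V) (hi : i ≤ T.ncard) (hT : T ≠ Set.univ) :
    (muLoop f i T s).2.steps +
        ∑ l ∈ Finset.range (Nat.card V), φ l (muLoop f i T s).2.stored ≤
      s.steps + ∑ l ∈ Finset.range (Nat.card V), φ l s.stored +
        (Nat.card V - T.ncard) * (3 + a) := by
  have hlt : ∀ T : Set V, T ≠ Set.univ → T.ncard < Nat.card V := fun T hT => by
    rw [← Set.ncard_univ]
    exact Set.ncard_lt_ncard (Set.ssubset_univ_iff.2 hT)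
  have hstep : ∀ i T s, i ≤ T.ncard → T ≠ Set.univ → (f i T s).2.steps +
      ∑ l ∈ Finset.range (Nat.card V), φ l (f i T s).2.stored ≤
      s.steps + ∑ l ∈ Finset.range (Nat.card V), φ l s.stored + a := by
    intro i T s hi hT
    have hmem : i ∈ Finset.range (Nat.card V) := Finset.mem_range.2 (hi.trans_lt (hlt T hT))
    rw [← Finset.add_sum_erase _ _ hmem, ← Finset.add_sum_erase _ (fun l => φ l s.stored) hmem,
      Finset.sum_congr rfl fun l hl => hne i l T s (Finset.ne_of_mem_erase hl)]
    have := hf i T s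
    omega
  induction i, T, s using muLoop.induct f with
  | case1 i T s r T' h =>
    rw [muLoop, dif_pos h]
    have := hstep i T s hi hT
    have h1 : 1 * (3 + a) ≤ (Nat.card V - T.ncard) * (3 + a) :=
      Nat.mul_le_mul_right _ (Nat.sub_pos_of_lt (hlt T hT))
    simp only [Mem.tick]
    omega
  | case2 i T s r T' h h' =>
    rw [muLoop, dif_neg h, if_pos h']
    have := hstep i T s hi hT
    have h1 : 1 * (3 + a) ≤ (Nat.card V - T.ncard) * (3 + a) :=
      Nat.mul_le_mul_right _ (Nat.sub_pos_of_lt (hlt T hT))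
    simp only [Mem.tick]
    omega
  | case3 i T s r T' s' h h' ih =>
    rw [muLoop, dif_neg h, if_neg h']
    have hTT' : T.ncard < T'.ncard :=
      Set.ncard_lt_ncard (Set.subset_union_left.ssubset_of_ne (Ne.symm h))
    have h2 := ih (by omega) h'
    have h1 := hstep i T s hi hT
    have h3 : (Nat.card V - T'.ncard + 1) * (3 + a) ≤ (Nat.card V - T.ncard) * (3 + a) :=
      Nat.mul_le_mul_right _ (by have := hlt T' h'; omega)
    rw [add_mul, one_mul] at h3
    have hs1 : s'.steps = (f i T s).2.steps + 3 := rfl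
    have hs2 : s'.stored = (f i T s).2.stored := rfl
    rw [hs1, hs2] at h2
    change (muLoop f (i + 1) T' s').2.steps +
      ∑ l ∈ Finset.range (Nat.card V), φ l (muLoop f (i + 1) T' s').2.stored ≤ _
    omega

/-- Each iteration but the last removes a vertex, releasing `2 + a` of potential; the last one is
the extra `2 + a`. -/
theorem nuLoop_steps {ψ : (List ℕ → Set V) → ℕ} {a : ℕ} {g : Set V → Mem V → Set V × Mem V}
    (hg : ∀ S s, (g S s).2.steps + ψ (g S s).2.stored ≤ s.steps + ψ s.stored + a)
    (S : Set V) (s : Mem V) :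
    (nuLoop g S s).2.steps + ψ (nuLoop g S s).2.stored + (2 + a) * (nuLoop g S s).1.ncard ≤
      s.steps + ψ s.stored + (2 + a) * S.ncard + (2 + a) := by
  induction S, s using nuLoop.induct g with
  | case1 S s r S' h =>
    rw [nuLoop, dif_pos h]
    have := hg S s
    simp only [Mem.tick]
    omega
  | case2 S s r S' s' h ih =>
    rw [nuLoop, dif_neg h]
    have hSS' : S'.ncard < S.ncard :=
      Set.ncard_lt_ncard (Set.inter_subset_left.ssubset_of_ne h)
    have h1 := hg S s
    have h3 : (2 + a) * (S'.ncard + 1) ≤ (2 + a) * S.ncard := Nat.mul_le_mul_left _ hSS'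
    rw [mul_add, mul_one] at h3
    have hs1 : s'.steps = (g S s).2.steps + 2 := rfl
    have hs2 : s'.stored = (g S s).2.stored := rfl
    rw [hs1, hs2] at ih
    change (nuLoop g S' s').2.steps + ψ (nuLoop g S' s').2.stored +
      (2 + a) * (nuLoop g S' s').1.ncard ≤ _
    omega

theorem paritySolve_steps [Nonempty V] (j : ℕ) (δ : List ℕ) (W : ℕ → Set V) (s : Mem V) :
    (G.paritySolve k C j δ W s).2.steps +
        potential (Nat.card V) k j δ (G.paritySolve k C j δ W s).2.stored ≤
      s.steps + potential (Nat.card V) k j δ s.stored + amortizedSteps (Nat.card V) k j := by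
  induction j generalizing δ W s with
  | zero =>
    simp only [paritySolve, potential, amortizedSteps, Mem.tick, body_fst_snd]
    omega
  | succ j ih =>
    have key := nuLoop_steps
      (ψ := fun st => ∑ i ∈ Finset.range (Nat.card V), potential (Nat.card V) k j (i :: δ) st)
      (a := Nat.card V * (3 + amortizedSteps (Nat.card V) k j))
      (g := fun S => muLoop
        (fun i T => paritySolve G k C j (i :: δ) (assign W (j + 1) S T)) 0 ∅)
      (fun S s => by
        have := muLoop_steps (φ := fun i => potential (Nat.card V) k j (i :: δ))
          (f := fun i T => paritySolve G k C j (i :: δ) (assign W (j + 1) S T))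
          (fun i T s => ih _ _ _)
          (fun i i' T s hi => potential_congr _ _ _ _ fun κ hκ =>
            paritySolve_stored _ _ _ _ _ (not_cons_suffix_of_ne hi hκ))
          0 ∅ s (Nat.zero_le _) Set.empty_ne_univ
        simpa using this)
      (s.stored δ) (s.tick 1)
    rw [paritySolve]
    simp only [potential_update, Mem.tick, Mem.store] at key ⊢
    rw [potential, amortizedSteps]
    omega

variable (G k C) in
theorem paritySteps_le [Nonempty V] (hk : 1 ≤ k) :
    G.paritySteps k C ≤ 46 * k ^ 2 * Nat.card V ^ (k + 1) := by
  have hn : 1 ≤ Nat.card V := Nat.card_pos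
  have h := paritySolve_steps (G := G) (k := k) (C := C) k [] (fun _ => ∅)
    ⟨0, fun _ => Set.univ⟩
  have h1 := amortizedSteps_le hn k k
  have h2 := potential_univ_le hn rfl k k []
  have h3 : Nat.card V ^ k ≤ Nat.card V ^ (k + 1) := Nat.pow_le_pow_right hn k.le_succ
  calc G.paritySteps k C
      ≤ k * Nat.card V ^ (k + 1) * (16 * k + 7 * k) + Nat.card V ^ k * (16 * k + 7 * k) := by
        rw [paritySteps, parityRun]
        dsimp only at h
        omega
    _ ≤ k * Nat.card V ^ (k + 1) * (16 * k + 7 * k) +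
        k * Nat.card V ^ (k + 1) * (16 * k + 7 * k) := by
        gcongr
        exact h3.trans (Nat.le_mul_of_pos_left _ hk)
    -- `46 = 2 * (16 + 7)`: the initial potential and the amortized cost of the run are each bounded
    -- by `23 * k ^ 2 * n ^ (k + 1)`.
    _ = 46 * k ^ 2 * Nat.card V ^ (k + 1) := by ring

end Loops

end LiveGame

/-! ### Lexicographic comparison of prefixes -/

theorem List.cons_le_cons_iff_lt_or {a b : ℕ} {l l' : List ℕ} :
    a :: l ≤ b :: l' ↔ a < b ∨ a = b ∧ l ≤ l' := by
  rw [le_iff_lt_or_eq, le_iff_lt_or_eq, List.cons_lt_cons_iff, List.cons.injEq, and_or_left,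
    or_assoc]

theorem List.nil_le_of_nat (l : List ℕ) : [] ≤ l :=
  not_lt.1 (List.not_lt_nil l)

theorem List.take_le_take_of_le {l l' : List ℕ} (h : l ≤ l') (n : ℕ) : l.take n ≤ l'.take n := by
  induction n generalizing l l' with
  | zero => exact le_of_eq (by simp)
  | succ n ih =>
    match l, l' with
    | [], _ => exact List.nil_le_of_nat _
    | a :: l, [] => exact absurd (List.nil_lt_cons a l) (not_lt.2 h)
    | a :: l, b :: l' =>
      rw [List.cons_le_cons_iff_lt_or] at h
      rw [List.take_succ_cons, List.take_succ_cons, List.cons_le_cons_iff_lt_or]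
      exact h.imp_right fun h => ⟨h.1, ih h.2⟩

theorem List.take_le_take_of_take_le {l l' : List ℕ} {m n : ℕ} (h : l.take n ≤ l'.take n)
    (hmn : m ≤ n) : l.take m ≤ l'.take m := by
  simpa [List.take_take, hmn] using List.take_le_take_of_le h m

namespace LiveGame

variable {V : Type*} {G : LiveGame V} {k : ℕ} {C : ℕ → Set V}

/-! ### The valuations that witness membership and non-membership -/

theorem exists_valuation_of_mem [Finite V] (j : ℕ) (W : ℕ → Set V) (v : V)
    (hv : v ∈ G.parityNest k C j W) :
    ∃ W' : ℕ → Set V, (∀ i, 2 * j < i → W' i = W i) ∧ v ∈ G.parityBody k C W' ∧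
      ∀ m, 1 ≤ m → m ≤ j →
        (∀ u ∈ W' (2 * m), u ∈ G.parityNest k C j W ∧
          (G.parityRank k C j W u).take (j - m) ≤ (G.parityRank k C j W v).take (j - m)) ∧
        ∀ u ∈ W' (2 * m - 1), u ∈ G.parityNest k C j W ∧
          (G.parityRank k C j W u).take (j + 1 - m) < (G.parityRank k C j W v).take (j + 1 - m) := by
  induction j generalizing W with
  | zero => exact ⟨W, fun _ _ => rfl, hv, fun m h1 h2 => by omega⟩
  | succ j ih =>
    set S := G.parityNest k C (j + 1) W with hS
    set F := G.parityInner k C j W S with hF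
    have hFm : Monotone F := parityInner_mono j W S
    have hSF : mu F = S := map_nu (parityOuter_mono j W)
    set ι : V → ℕ := fun u => sInf {i : ℕ | u ∈ F^[i + 1] ∅} with hι
    have hrank : ∀ u, G.parityRank k C (j + 1) W u =
      ι u :: G.parityRank k C j (assign W (j + 1) S (F^[ι u] ∅)) u := fun _ => rfl
    have hle : ∀ {u i}, u ∈ F^[i + 1] ∅ → ι u ≤ i := fun h => Nat.sInf_le h
    have hmem : ∀ {u i}, u ∈ F^[i] ∅ → u ∈ S := fun h => hSF ▸ iterate_le_mu hFm _ h
    have hιv : v ∈ F^[ι v + 1] ∅ :=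
      Nat.sInf_mem (s := {i : ℕ | v ∈ F^[i + 1] ∅})
        (exists_mem_iterate_of_mem_mu hFm (hSF.symm ▸ hv))
    rw [Function.iterate_succ_apply'] at hιv
    -- `X` receives iterate `ι v`, which just misses `v`, so its elements have a smaller leading
    -- rank entry.
    obtain ⟨W', hW', hbody, hW'm⟩ := ih (assign W (j + 1) S (F^[ι v] ∅)) hιv
    refine ⟨W', fun i hi => ?_, hbody, fun m h1 h2 => ?_⟩
    · rw [hW' i (by omega), assign_of_lt W j S _ (by omega)]
    obtain rfl | hm : m = j + 1 ∨ m ≤ j := by omega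
    · rw [hW' _ (by omega), hW' _ (by omega), assign_even, assign_odd]
      refine ⟨fun u hu => ⟨hu, by simp⟩, fun u hu => ⟨hmem hu, ?_⟩⟩
      have hlt : ι u < ι v := by
        obtain ⟨i, hi⟩ : ∃ i, ι v = i + 1 :=
          Nat.exists_eq_succ_of_ne_zero fun h0 => by rw [h0] at hu; exact hu
        rw [hi] at hu ⊢
        exact Nat.lt_succ_of_le (hle hu)
      rw [show j + 1 + 1 - (j + 1) = 1 by omega, hrank, hrank]
      simpa [List.cons_lt_cons_iff] using hlt
    · have hIH := hW'm m h1 hm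
      have hstep : ∀ u ∈ G.parityNest k C j (assign W (j + 1) S (F^[ι v] ∅)),
          u ∈ S ∧ ι u ≤ ι v := by
        intro u hu
        have hu' : u ∈ F^[ι v + 1] ∅ := by
          rw [Function.iterate_succ_apply']
          exact hu
        exact ⟨hmem hu', hle hu'⟩
      rw [hrank, show j + 1 - m = (j - m) + 1 by omega,
        show j + 1 + 1 - m = (j + 1 - m) + 1 by omega, List.take_succ_cons, List.take_succ_cons]
      constructor
      · intro u hu
        obtain ⟨hu1, hu2⟩ := hIH.1 u hu
        refine ⟨(hstep u hu1).1, ?_⟩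
        rw [hrank, List.take_succ_cons, List.cons_le_cons_iff_lt_or]
        -- With equal leading entries both inner ranks are computed in the same valuation, so the
        -- induction hypothesis applies; otherwise the leading entry decides.
        refine (hstep u hu1).2.lt_or_eq.imp_right fun h => ⟨h, ?_⟩
        rw [h]
        exact hu2
      · intro u hu
        obtain ⟨hu1, hu2⟩ := hIH.2 u hu
        refine ⟨(hstep u hu1).1, ?_⟩
        rw [hrank, List.take_succ_cons, List.cons_lt_cons_iff]
        refine (hstep u hu1).2.lt_or_eq.imp_right fun h => ⟨h, ?_⟩
        rw [h]
        exact hu2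

variable (G k C) in
/-- The rank of a vertex outside `parityNest k C j W`: the list `i_j, …, i_1`, where `i_j` is
minimal such that the vertex is missing from the iterate number `i_j + 1` for `Y_{2j}` (iterate
`0` is `univ`), and `i_{j-1}, …, i_1` are found in the same way in the evaluation of the inner
fixpoints which produces this iterate from iterate number `i_j`. -/
noncomputable def parityCorank : ℕ → (ℕ → Set V) → V → List ℕ
  | 0, _, _ => []
  | j + 1, W, v =>
    let F := G.parityOuter k C j W
    let i := sInf {i : ℕ | v ∉ F^[i + 1] Set.univ}
    i :: parityCorank j (assign W (j + 1) (F^[i] Set.univ) (F^[i + 1] Set.univ)) v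

/-- Dually, `Y` takes the last iterate that contains `v` and `X` its least fixpoint for that `Y`,
which is the next iterate of `Y`. A vertex missing from `Y` was removed strictly earlier than `v`;
one missing from `X` no later. -/
theorem exists_valuation_of_notMem [Finite V] (j : ℕ) (W : ℕ → Set V) (v : V)
    (hv : v ∉ G.parityNest k C j W) :
    ∃ W' : ℕ → Set V, (∀ i, 2 * j < i → W' i = W i) ∧ v ∉ G.parityBody k C W' ∧
      ∀ m, 1 ≤ m → m ≤ j →
        (∀ u ∉ W' (2 * m), u ∉ G.parityNest k C j W ∧ (G.parityCorank k C j W u).take (j + 1 - m) <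
          (G.parityCorank k C j W v).take (j + 1 - m)) ∧
        ∀ u ∉ W' (2 * m - 1), u ∉ G.parityNest k C j W ∧
          (G.parityCorank k C j W u).take (j + 1 - m) ≤
            (G.parityCorank k C j W v).take (j + 1 - m) := by
  induction j generalizing W with
  | zero => exact ⟨W, fun _ _ => rfl, hv, fun m h1 h2 => by omega⟩
  | succ j ih =>
    set F := G.parityOuter k C j W with hF
    have hFm : Monotone F := parityOuter_mono j W
    set ι : V → ℕ := fun u => sInf {i : ℕ | u ∉ F^[i + 1] Set.univ} with hι
    set A : ℕ → ℕ → Set V := fun i =>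
      assign W (j + 1) (F^[i] Set.univ) (F^[i + 1] Set.univ) with hA
    have hAe : ∀ i, A i (2 * (j + 1)) = F^[i] Set.univ := fun _ => assign_even _ _ _ _
    have hAo : ∀ i, A i (2 * (j + 1) - 1) = F^[i + 1] Set.univ := fun _ => assign_odd _ _ _ _
    have hrank : ∀ u, G.parityCorank k C (j + 1) W u =
      ι u :: G.parityCorank k C j (A (ι u)) u := fun _ => rfl
    have hnest : ∀ i, G.parityNest k C j (A i) = F^[i + 1] Set.univ := by
      intro i
      have := map_mu (parityInner_mono (G := G) (k := k) (C := C) j W (F^[i] Set.univ))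
      simp only [hA, Function.iterate_succ_apply']
      exact this
    have hle : ∀ {u i}, u ∉ F^[i + 1] Set.univ → ι u ≤ i := fun h => Nat.sInf_le h
    have hmem : ∀ {u i}, u ∉ F^[i] Set.univ → u ∉ G.parityNest k C (j + 1) W :=
      fun h h' => h (nu_le_iterate hFm _ h')
    have hιv : v ∉ F^[ι v + 1] Set.univ :=
      Nat.sInf_mem (s := {i : ℕ | v ∉ F^[i + 1] Set.univ})
        (exists_notMem_iterate_of_notMem_nu hFm hv)
    rw [← hnest] at hιv
    obtain ⟨W', hW', hbody, hW'm⟩ := ih (A (ι v)) hιv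
    refine ⟨W', fun i hi => ?_, hbody, fun m h1 h2 => ?_⟩
    · rw [hW' i (by omega)]
      exact assign_of_lt W j _ _ hi
    obtain rfl | hm : m = j + 1 ∨ m ≤ j := by omega
    · rw [hW' _ (by omega), hW' _ (by omega), hAe, hAo,
        show j + 1 + 1 - (j + 1) = 1 by omega, hrank]
      refine ⟨fun u hu => ⟨hmem hu, ?_⟩, fun u hu => ⟨hmem hu, ?_⟩⟩
      · have hlt : ι u < ι v := by
          obtain ⟨i, hi⟩ : ∃ i, ι v = i + 1 :=
            Nat.exists_eq_succ_of_ne_zero fun h0 => by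
              rw [h0] at hu
              exact hu (Set.mem_univ u)
          rw [hi] at hu ⊢
          exact Nat.lt_succ_of_le (hle hu)
        rw [hrank]
        simpa [List.cons_lt_cons_iff] using hlt
      · rw [hrank]
        simpa [List.cons_le_cons_iff_lt_or, ← le_iff_lt_or_eq] using hle hu
    · have hIH := hW'm m h1 hm
      have hstep : ∀ u ∉ G.parityNest k C j (A (ι v)),
          u ∉ G.parityNest k C (j + 1) W ∧ ι u ≤ ι v := by
        intro u hu
        rw [hnest] at hu
        exact ⟨hmem hu, hle hu⟩
      rw [hrank, show j + 1 + 1 - m = (j + 1 - m) + 1 by omega, List.take_succ_cons]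
      constructor
      · intro u hu
        obtain ⟨hu1, hu2⟩ := hIH.1 u hu
        refine ⟨(hstep u hu1).1, ?_⟩
        rw [hrank, List.take_succ_cons, List.cons_lt_cons_iff]
        refine (hstep u hu1).2.lt_or_eq.imp_right fun h => ⟨h, ?_⟩
        rw [h]
        exact hu2
      · intro u hu
        obtain ⟨hu1, hu2⟩ := hIH.2 u hu
        refine ⟨(hstep u hu1).1, ?_⟩
        rw [hrank, List.take_succ_cons, List.cons_le_cons_iff_lt_or]
        refine (hstep u hu1).2.lt_or_eq.imp_right fun h => ⟨h, ?_⟩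
        rw [h]
        exact hu2

end LiveGame

/-! ### Colors -/

/-- `c` assigns to every vertex the index of its class. -/
def IsColorMap {V : Type*} (k : ℕ) (C : ℕ → Set V) (c : V → ℕ) : Prop :=
  (∀ v, 1 ≤ c v ∧ c v ≤ 2 * k) ∧ ∀ v i, 1 ≤ i → i ≤ 2 * k → (v ∈ C i ↔ c v = i)

theorem IsParityColoring.exists_colorMap {V : Type*} {k : ℕ} {C : ℕ → Set V}
    (hC : IsParityColoring k C) : ∃ c, IsColorMap k C c := by
  have h : ∀ v, ∃ i, (1 ≤ i ∧ i ≤ 2 * k) ∧ v ∈ C i := by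
    intro v
    have hv : v ∈ ⋃ i ∈ Set.Icc 1 (2 * k), C i := hC.1 ▸ Set.mem_univ v
    simpa using hv
  choose c hc hcv using h
  refine ⟨c, hc, fun v i h1 h2 => ⟨fun hv => ?_, fun h => h ▸ hcv v⟩⟩
  by_contra hne
  have := hC.2 (c v) (hc v) i ⟨h1, h2⟩ hne
  exact Set.notMem_empty v (this ▸ ⟨hcv v, hv⟩)

theorem IsColorMap.mem_parityBody {V : Type*} {k : ℕ} {C : ℕ → Set V} {c : V → ℕ}
    (hc : IsColorMap k C c) (G : LiveGame V) (W : ℕ → Set V) (v : V) :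
    v ∈ G.parityBody k C W ↔ ∃ j, 1 ≤ j ∧ j ≤ k ∧ ((c v = 2 * j ∧ v ∈ G.cpre (W (2 * j))) ∨
      (c v < 2 * j ∧ v ∈ G.apre (W (2 * j)) (W (2 * j - 1)))) := by
  simp only [LiveGame.parityBody, Set.mem_iUnion, Set.mem_Icc, Set.mem_union, Set.mem_inter_iff,
    exists_prop, and_assoc]
  refine exists_congr fun j => and_congr_right fun h1 => and_congr_right fun h2 => or_congr ?_ ?_
  · rw [hc.2 v (2 * j) (by omega) (by omega)]
  · refine and_congr_left fun _ => ⟨?_, fun h => ?_⟩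
    · rintro ⟨i, hi1, hi2, hv⟩
      rw [(hc.2 v i hi1 (by omega)).1 hv]
      omega
    · exact ⟨c v, (hc.1 v).1, by omega, (hc.2 v _ (hc.1 v).1 (hc.1 v).2).2 rfl⟩

/-! ### The vertices that a play visits infinitely often -/

section Limit

variable {V : Type*} [Finite V] {π : ℕ → V}

theorem InfOften.exists_mem {A : Set V} (h : InfOften π A) : ∃ v ∈ A, InfOften π {v} := by
  by_contra! hA
  have h1 : ∀ v ∈ A, ∀ᶠ i in Filter.atTop, π i ≠ v := by
    intro v hv
    have := hA v hv
    simp only [InfOften, not_forall, not_exists, not_and] at this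
    obtain ⟨n, hn⟩ := this
    exact Filter.eventually_atTop.2 ⟨n, fun m hm => hn m hm⟩
  rw [← Filter.eventually_all_finite A.toFinite, Filter.eventually_atTop] at h1
  obtain ⟨n, hn⟩ := h1
  obtain ⟨m, hm, hmA⟩ := h n
  exact hn m hm _ hmA rfl

variable (π) in
theorem exists_forall_ge_infOften : ∃ n, ∀ m ≥ n, InfOften π {π m} := by
  have h : ∀ v, ∀ᶠ m in Filter.atTop, π m = v → InfOften π {v} := by
    intro v
    by_cases hv : InfOften π {v}
    · exact Filter.Eventually.of_forall fun _ _ => hv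
    · simp only [InfOften, not_forall, not_exists, not_and] at hv
      obtain ⟨n, hn⟩ := hv
      exact Filter.eventually_atTop.2 ⟨n, fun m hm h => absurd h (hn m hm)⟩
  obtain ⟨n, hn⟩ := Filter.eventually_atTop.1 (Filter.eventually_all.2 h)
  exact ⟨n, fun m hm => hn m hm _ rfl⟩

theorem InfOften.exists_succ {v : V} (h : InfOften π {v}) :
    ∃ i, π i = v ∧ InfOften π {π (i + 1)} := by
  obtain ⟨n, hn⟩ := exists_forall_ge_infOften π
  obtain ⟨m, hm, hv⟩ := h n
  exact ⟨m, hv, hn _ (by omega)⟩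

/-- If `f` can increase along the play only after vertices for which some vertex visited
infinitely often has a smaller value, then `f` is constant on the limit set. -/
theorem not_lt_of_infOften {α : Type*} [LinearOrder α] {f : V → α}
    (h : ∀ v, InfOften π {v} →
      (∀ i, π i = v → f (π (i + 1)) ≤ f v) ∨ ∃ w, InfOften π {w} ∧ f w < f v)
    {v w : V} (hv : InfOften π {v}) (hw : InfOften π {w}) : ¬ f w < f v := by
  -- After a visit to a minimal limit vertex the second alternative never applies, so the value
  -- cannot rise above the minimum again.
  obtain ⟨a, ha, hmin⟩ := Set.exists_min_image {v | InfOften π {v}} f (Set.toFinite _) ⟨v, hv⟩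
  obtain ⟨n, hn⟩ := exists_forall_ge_infOften π
  obtain ⟨t, ht, hta⟩ := ha n
  have key : ∀ m ≥ t, f (π m) ≤ f a := by
    intro m hm
    induction m, hm using Nat.le_induction with
    | base => exact le_of_eq (congrArg f hta)
    | succ m hm ih =>
      obtain h | ⟨w, hw, hlt⟩ := h (π m) (hn m (by omega))
      · exact (h m rfl).trans ih
      · exact absurd (hlt.trans_le ih) (not_lt.2 (hmin w hw))
  obtain ⟨m, hm, hmv⟩ := hv t
  intro hlt
  have := key m hm
  rw [show π m = v from hmv] at this
  exact absurd (hlt.trans_le this) (not_lt.2 (hmin w hw))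

end Limit

namespace LiveGame

variable {V : Type*} {G : LiveGame V} {k : ℕ} {C : ℕ → Set V}

/-! ### The rank-minimizing strategy wins from the fixpoint -/

theorem exists_succ_of_mem_cpre (hE : ∀ v, ∃ w, G.E v w) {v : V} {S : Set V}
    (hv : v ∈ G.cpre S) : ∃ w, G.E v w ∧ w ∈ S := by
  obtain ⟨-, w, hw⟩ | ⟨-, h⟩ := hv
  · exact ⟨w, hw⟩
  · obtain ⟨w, hw⟩ := hE v
    exact ⟨w, hw, h w hw⟩

theorem mem_cpre_of_mem_apre {v : V} {S T : Set V} (hv : v ∈ G.apre S T) (h0 : v ∈ G.V0) :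
    v ∈ G.cpre T :=
  hv.resolve_right fun h => h.2.1 h0

theorem exists_succ_mem_parityFixpoint [Finite V] (hE : ∀ v, ∃ w, G.E v w) {c : V → ℕ}
    (hc : IsColorMap k C c) {v : V} (h0 : v ∈ G.V0) (hv : v ∈ G.parityFixpoint k C) :
    ∃ w, G.E v w ∧ w ∈ G.parityFixpoint k C := by
  obtain ⟨W, -, hbody, hW⟩ := exists_valuation_of_mem k _ v hv
  obtain ⟨j, h1, h2, ⟨-, h⟩ | ⟨-, h⟩⟩ := (hc.mem_parityBody G W v).1 hbody
  · obtain ⟨w, hw, hwS⟩ := exists_succ_of_mem_cpre hE h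
    exact ⟨w, hw, ((hW j h1 h2).1 w hwS).1⟩
  · obtain ⟨w, hw, hwS⟩ := exists_succ_of_mem_cpre hE (mem_cpre_of_mem_apre h h0)
    exact ⟨w, hw, ((hW j h1 h2).2 w hwS).1⟩

theorem exists_isRankMinimizing [Finite V] (hE : ∀ v, ∃ w, G.E v w) {c : V → ℕ}
    (hc : IsColorMap k C c) :
    ∃ ρ, G.IsStrategy0 ρ ∧ G.IsMemoryless0 ρ ∧ G.IsRankMinimizing k C ρ := by
  have h : ∀ v, ∃ w, G.E v w ∧ (v ∈ G.V0 ∩ G.parityFixpoint k C → w ∈ G.parityFixpoint k C ∧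
      ∀ u ∈ G.parityFixpoint k C, G.E v u →
        G.parityRank k C k (fun _ => ∅) w ≤ G.parityRank k C k (fun _ => ∅) u) := by
    intro v
    by_cases hv : v ∈ G.V0 ∩ G.parityFixpoint k C
    · obtain ⟨w, hw, hmin⟩ := Set.exists_min_image {w | G.E v w ∧ w ∈ G.parityFixpoint k C}
        (G.parityRank k C k fun _ => ∅) (Set.toFinite _)
        (exists_succ_mem_parityFixpoint hE hc hv.1 hv.2)
      exact ⟨w, hw.1, fun _ => ⟨hw.2, fun u hu hvu => hmin u ⟨hvu, hu⟩⟩⟩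
    · obtain ⟨w, hw⟩ := hE v
      exact ⟨w, hw, fun h => absurd h hv⟩
  choose σ hσ hσ' using h
  exact ⟨fun _ v => σ v, fun _ v _ => hσ v, fun _ _ _ _ => rfl, fun _ v hv => hσ' v hv⟩

variable (G k C) in
/-- The entries of the rank for the variables `X_{2k-1}, …, X_{2m-1}`. -/
noncomputable def rankPrefix (m : ℕ) (v : V) : List ℕ :=
  (G.parityRank k C k (fun _ => ∅) v).take (k + 1 - m)

theorem rankPrefix_le_of_le {m m' : ℕ} (h : m' ≤ m) {u v : V}
    (huv : G.rankPrefix k C m' u ≤ G.rankPrefix k C m' v) :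
    G.rankPrefix k C m u ≤ G.rankPrefix k C m v :=
  List.take_le_take_of_take_le huv (by omega)

theorem exists_row_of_mem [Finite V] {c : V → ℕ} (hc : IsColorMap k C c)
    {ρ : List V → V → V} (hρ : G.IsRankMinimizing k C ρ) {v : V}
    (hv : v ∈ G.parityFixpoint k C) :
    ∃ j, 1 ≤ j ∧ j ≤ k ∧ c v ≤ 2 * j ∧
      (∀ u, (v ∈ G.V0 → ∃ h, u = ρ h v) → (v ∈ G.V1 → G.E v u) →
        u ∈ G.parityFixpoint k C ∧ G.rankPrefix k C (j + 1) u ≤ G.rankPrefix k C (j + 1) v) ∧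
      (c v = 2 * j ∨
        (∀ u, (v ∈ G.V0 → ∃ h, u = ρ h v) → (v ∈ G.V1 → G.E v u) →
          G.rankPrefix k C j u < G.rankPrefix k C j v) ∨
        ∃ w, G.El v w ∧ G.rankPrefix k C j w < G.rankPrefix k C j v) := by
  obtain ⟨W, -, hbody, hW⟩ := exists_valuation_of_mem k _ v hv
  obtain ⟨j, h1, h2, hj⟩ := (hc.mem_parityBody G W v).1 hbody
  have hY : ∀ u ∈ W (2 * j), u ∈ G.parityFixpoint k C ∧
      G.rankPrefix k C (j + 1) u ≤ G.rankPrefix k C (j + 1) v := by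
    have := (hW j h1 h2).1
    rwa [show k - j = k + 1 - (j + 1) by omega] at this
  have hX : ∀ u ∈ W (2 * j - 1), u ∈ G.parityFixpoint k C ∧
      G.rankPrefix k C j u < G.rankPrefix k C j v := (hW j h1 h2).2
  -- Truncation preserves `≤`, so the least-rank move is at least as good as any witness successor,
  -- for all prefixes at once.
  have hmin : v ∈ G.V0 → ∀ h w, G.E v w → w ∈ G.parityFixpoint k C →
      ρ h v ∈ G.parityFixpoint k C ∧ ∀ m, G.rankPrefix k C m (ρ h v) ≤ G.rankPrefix k C m w :=
    fun h0 h w hw hwZ => ⟨(hρ h v ⟨h0, hv⟩).1, fun m =>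
      List.take_le_take_of_le ((hρ h v ⟨h0, hv⟩).2 w hwZ hw) _⟩
  have hcpreY : v ∈ G.cpre (W (2 * j)) →
      ∀ u, (v ∈ G.V0 → ∃ h, u = ρ h v) → (v ∈ G.V1 → G.E v u) →
        u ∈ G.parityFixpoint k C ∧ G.rankPrefix k C (j + 1) u ≤ G.rankPrefix k C (j + 1) v := by
    rintro (⟨h0, w, hw, hwS⟩ | ⟨h0, h⟩) u hu hu'
    · obtain ⟨g, rfl⟩ := hu h0
      obtain ⟨h3, h4⟩ := hmin h0 g w hw (hY w hwS).1
      exact ⟨h3, (h4 _).trans (hY w hwS).2⟩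
    · exact hY u (h u (hu' h0))
  have hcpreX : v ∈ G.cpre (W (2 * j - 1)) →
      ∀ u, (v ∈ G.V0 → ∃ h, u = ρ h v) → (v ∈ G.V1 → G.E v u) →
        u ∈ G.parityFixpoint k C ∧ G.rankPrefix k C j u < G.rankPrefix k C j v := by
    rintro (⟨h0, w, hw, hwS⟩ | ⟨h0, h⟩) u hu hu'
    · obtain ⟨g, rfl⟩ := hu h0
      obtain ⟨h3, h4⟩ := hmin h0 g w hw (hX w hwS).1
      exact ⟨h3, (h4 _).trans_lt (hX w hwS).2⟩
    · exact hX u (h u (hu' h0))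
  refine ⟨j, h1, h2, ?_⟩
  obtain ⟨hcj, h⟩ | ⟨hcj, h | ⟨⟨w, hw, hwX⟩, h⟩⟩ := hj
  · exact ⟨hcj.le, hcpreY h, .inl hcj⟩
  · refine ⟨hcj.le, fun u hu hu' => ⟨(hcpreX h u hu hu').1, ?_⟩,
      .inr (.inl fun u hu hu' => (hcpreX h u hu hu').2)⟩
    exact rankPrefix_le_of_le j.le_succ (hcpreX h u hu hu').2.le
  · exact ⟨hcj.le, hcpreY (.inr h), .inr (.inr ⟨w, hw, (hX w hwX).2⟩)⟩

theorem winsFromWith_of_isRankMinimizing [Finite V] {c : V → ℕ} (hc : IsColorMap k C c)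
    {ρ : List V → V → V} (hρ : G.IsRankMinimizing k C ρ) {v : V}
    (hv : v ∈ G.parityFixpoint k C) :
    G.WinsFromWith (G.fairly (parityCondition k C)) ρ v := by
  rintro ρ₁ hρ₁ π ⟨hπ0, hπ⟩ hfair i hi hodd
  by_contra! heven
  choose! lev hlev1 hlevk hlevc hlev hdec using
    fun v (hv : v ∈ G.parityFixpoint k C) => exists_row_of_mem hc hρ hv
  have hn0 : ∀ m, π m ∈ G.V0 → ∃ h, π (m + 1) = ρ h (π m) := fun m h => ⟨_, (hπ m).1 h⟩
  have hn1 : ∀ m, π m ∈ G.V1 → G.E (π m) (π (m + 1)) := fun m h => by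
    rw [(hπ m).2 h]
    exact hρ₁ _ _ h
  have hZ : ∀ m, π m ∈ G.parityFixpoint k C := by
    intro m
    induction m with
    | zero => exact hπ0 ▸ hv
    | succ m ih => exact (hlev _ ih _ (hn0 m) (hn1 m)).1
  have hinfZ : ∀ v, InfOften π {v} → v ∈ G.parityFixpoint k C := by
    intro v hv
    obtain ⟨m, -, hm⟩ := hv 0
    exact hm ▸ hZ m
  obtain ⟨v₀, hv₀, hinf₀⟩ := hodd.exists_mem
  obtain ⟨a, ha, hmax⟩ := Set.exists_max_image {v | InfOften π {v}} lev (Set.toFinite _) ⟨v₀, hinf₀⟩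
  have haZ := hinfZ a ha
  have hiJ : i ≤ lev a := by
    have h1 := hlevc v₀ (hinfZ v₀ hinf₀)
    have h2 := hmax v₀ hinf₀
    rw [(hc.2 v₀ (2 * i - 1) (by have := hi.1; omega) (by have := hi.2; omega)).1 hv₀] at h1
    omega
  -- An even color `2 * lev a` is excluded by `heven`; a decrease on every move is realized by the
  -- play, a decrease along a live edge by fairness.
  have hdown : ∀ b, InfOften π {b} → lev b = lev a → ∃ w, InfOften π {w} ∧
      G.rankPrefix k C (lev a) w < G.rankPrefix k C (lev a) b := by
    intro b hb hba
    obtain h | h | ⟨w, hw, hlt⟩ := hdec b (hinfZ b hb)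
    · refine absurd (fun n => ?_) (heven (lev a) ⟨hiJ, hlevk a haZ⟩)
      obtain ⟨m, hm, rfl⟩ := hb n
      refine ⟨m, hm, (hc.2 _ _ ?_ ?_).2 (hba ▸ h)⟩
      · have := hlev1 a haZ
        omega
      · have := hlevk a haZ
        omega
    · obtain ⟨m, rfl, hm⟩ := hb.exists_succ
      exact ⟨_, hm, hba ▸ h _ (hn0 m) (hn1 m)⟩
    · refine ⟨w, fun n => ?_, hba ▸ hlt⟩
      obtain ⟨m, hm, -, hmw⟩ := hfair b w hw hb n
      exact ⟨m + 1, by omega, hmw⟩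
  obtain ⟨w, hw, hlt⟩ := hdown a ha rfl
  refine not_lt_of_infOften (fun b hb => ?_) ha hw hlt
  obtain h | h := (hmax b hb).lt_or_eq
  · left
    rintro m rfl
    exact rankPrefix_le_of_le h (hlev _ (hinfZ _ hb) _ (hn0 m) (hn1 m)).2
  · exact .inr (hdown b hb h)

/-! ### Plays and rotating strategies -/

/-- Iterates the step on pairs of past history and current vertex. -/
theorem exists_compliantPlay (G : LiveGame V) (ρ₀ ρ₁ : List V → V → V) (v : V) :
    ∃ π, G.IsCompliantPlay ρ₀ ρ₁ v π := by
  classical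
  let next : List V × V → List V × V := fun p =>
    (p.1 ++ [p.2], if p.2 ∈ G.V0 then ρ₀ p.1 p.2 else ρ₁ p.1 p.2)
  let st : ℕ → List V × V := fun i => next^[i] ([], v)
  have hst : ∀ i, st (i + 1) = next (st i) := fun i => Function.iterate_succ_apply' _ _ _
  have hhist : ∀ i, (st i).1 = history (fun j => (st j).2) i := by
    intro i
    induction i with
    | zero => rfl
    | succ i ih =>
      rw [hst, history, List.range_succ, List.map_append]
      exact congrArg (· ++ [(st i).2]) ih
  refine ⟨fun i => (st i).2, rfl, fun i => ⟨fun h => ?_, fun h => ?_⟩⟩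
  · rw [← hhist]
    exact (congrArg Prod.snd (hst i)).trans (if_pos h)
  · rw [← hhist]
    exact (congrArg Prod.snd (hst i)).trans (if_neg h)

theorem count_history [DecidableEq V] (π : ℕ → V) (v : V) (i : ℕ) :
    (history π i).count v = Nat.count (fun m => π m = v) i := by
  induction i with
  | zero => rfl
  | succ i ih =>
    rw [Nat.count_succ, ← ih, history, List.range_succ, List.map_append, List.count_append]
    simp [history, List.count_singleton]

theorem exists_rotation [Finite V] {R : Set V} (hR : R.Nonempty) :
    ∃ e : ℕ → V, (∀ n, e n ∈ R) ∧ ∀ u ∈ R, ∀ N, ∃ n ≥ N, e n = u := by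
  have := hR.to_subtype
  obtain ⟨f, hf⟩ := exists_surjective_nat R
  refine ⟨fun n => f n.unpair.1, fun n => (f _).2, fun u hu N => ?_⟩
  obtain ⟨a, ha⟩ := hf ⟨u, hu⟩
  exact ⟨Nat.pair a N, Nat.right_le_pair a N, by simp [ha]⟩

/-- Counting earlier visits to `v` sends visit number `n` (from 0) to `e n`. -/
theorem rotation_infOften [DecidableEq V] {π : ℕ → V} {v u : V} {e : ℕ → V}
    (hπ : ∀ i, π i = v → π (i + 1) = e ((history π i).count v)) (hv : InfOften π {v})
    (hu : ∀ N, ∃ n ≥ N, e n = u) (N : ℕ) : ∃ m ≥ N, π m = v ∧ π (m + 1) = u := by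
  have hinf : {m | π m = v}.Infinite := by
    rw [← Nat.frequently_atTop_iff_infinite, Filter.frequently_atTop]
    exact hv
  obtain ⟨n, hn, rfl⟩ := hu N
  have hmem := Nat.nth_mem_of_infinite hinf n
  refine ⟨Nat.nth (fun m => π m = v) n, hn.trans (Nat.nth_strictMono hinf).le_apply, hmem, ?_⟩
  rw [hπ _ hmem, count_history, Nat.count_nth fun hf => absurd hf hinf]

/-! ### Player 1 wins outside of the fixpoint -/

variable (G k C) in
/-- The entries of the corank for the variables `Y_{2k}, …, Y_{2m}`. -/
noncomputable def corankPrefix (m : ℕ) (v : V) : List ℕ :=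
  (G.parityCorank k C k (fun _ => ∅) v).take (k + 1 - m)

theorem corankPrefix_le_of_le {m m' : ℕ} (h : m' ≤ m) {u v : V}
    (huv : G.corankPrefix k C m' u ≤ G.corankPrefix k C m' v) :
    G.corankPrefix k C m u ≤ G.corankPrefix k C m v :=
  List.take_le_take_of_take_le huv (by omega)

theorem exists_succ_of_notMem_cpre {v : V} {S : Set V} (hv : v ∉ G.cpre S) (h1 : v ∈ G.V1) :
    ∃ u, G.E v u ∧ u ∉ S := by
  by_contra! h
  exact hv (.inr ⟨h1, h⟩)

/-- The moves `R` from a vertex `v` outside of the fixpoint between which Player 1 rotates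
(all moves if `v` belongs to Player 0). -/
theorem exists_moves_of_notMem [Finite V] (hE : ∀ v, ∃ w, G.E v w) {c : V → ℕ}
    (hc : IsColorMap k C c) {v : V} (hv : v ∉ G.parityFixpoint k C) :
    ∃ (m : ℕ) (R : Set V), 1 ≤ m ∧ m ≤ k ∧ R.Nonempty ∧
      (∀ u ∈ R, G.E v u ∧ u ∉ G.parityFixpoint k C ∧
        G.corankPrefix k C (m + 1) u ≤ G.corankPrefix k C (m + 1) v) ∧
      (v ∈ G.V0 → ∀ u, G.E v u → u ∈ R) ∧
      ((c v ≤ 2 * m ∧ (m = k ∨ v ∈ G.V0) ∧ ∀ u ∈ R, G.corankPrefix k C m u < G.corankPrefix k C m v) ∨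
       (c v ≤ 2 * m ∧ v ∈ G.V1 ∧ (∀ w, G.El v w → w ∈ R) ∧
          ∃ u ∈ R, G.corankPrefix k C m u < G.corankPrefix k C m v) ∨
       (c v = 2 * m - 1 ∧ (∀ w, G.El v w → w ∈ R) ∧
          ∀ u ∈ R, G.corankPrefix k C m u ≤ G.corankPrefix k C m v)) := by
  obtain ⟨W, -, hbody, hW⟩ := exists_valuation_of_notMem k _ v hv
  rw [hc.mem_parityBody] at hbody
  push Not at hbody
  have hY : ∀ m, 1 ≤ m → m ≤ k → ∀ u ∉ W (2 * m), u ∉ G.parityFixpoint k C ∧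
      G.corankPrefix k C m u < G.corankPrefix k C m v := fun m h1 h2 => (hW m h1 h2).1
  have hX : ∀ m, 1 ≤ m → m ≤ k → ∀ u ∉ W (2 * m - 1), u ∉ G.parityFixpoint k C ∧
      G.corankPrefix k C m u ≤ G.corankPrefix k C m v := fun m h1 h2 => (hW m h1 h2).2
  have hcv := hc.1 v
  obtain ⟨j, hj1, hjk, hcj⟩ : ∃ j, 1 ≤ j ∧ j ≤ k ∧ (c v = 2 * j ∨ c v = 2 * j - 1) :=
    ⟨(c v + 1) / 2, by omega, by omega, by omega⟩
  by_cases h0 : v ∈ G.V0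
  · have hsucc : ∀ S, v ∉ G.cpre S → ∀ u, G.E v u → u ∉ S := fun S hS u hu huS =>
      hS (.inl ⟨h0, u, hu, huS⟩)
    refine ⟨j, {u | G.E v u}, hj1, hjk, hE v, ?_⟩
    obtain hcj | hcj := hcj
    · have h := hsucc _ ((hbody j hj1 hjk).1 hcj)
      exact ⟨fun u hu => ⟨hu, (hY j hj1 hjk u (h u hu)).1,
          corankPrefix_le_of_le j.le_succ (hY j hj1 hjk u (h u hu)).2.le⟩, fun _ _ h => h,
        .inl ⟨hcj.le, .inr h0, fun u hu => (hY j hj1 hjk u (h u hu)).2⟩⟩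
    · have h := hsucc _ fun h => (hbody j hj1 hjk).2 (by omega) (.inl h)
      exact ⟨fun u hu => ⟨hu, (hX j hj1 hjk u (h u hu)).1,
          corankPrefix_le_of_le j.le_succ (hX j hj1 hjk u (h u hu)).2⟩, fun _ _ h => h,
        .inr (.inr ⟨hcj, fun w hw => G.live_edge v w hw,
          fun u hu => (hX j hj1 hjk u (h u hu)).2⟩)⟩
  · by_contra hgoal
    -- A move leaving `Y_{2m}` lowers the corank prefix, while live moves leaving `X_{2m+1}` do not
    -- raise the coarser one. For `m = k` no row above bounds the live moves, so they are dropped: a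
    -- strict decrease at the top level prevents `v` from recurring.
    have hdec : ∀ m u, 1 ≤ m → m ≤ k → c v ≤ 2 * m → G.E v u → u ∉ W (2 * m) →
        (m < k → ∀ w, G.El v w → w ∉ W (2 * (m + 1) - 1)) → False := by
      intro m u hm1 hmk hcm hu huW hlive
      have huY := hY m hm1 hmk u huW
      have huE := And.intro hu
        (And.intro huY.1 (corankPrefix_le_of_le m.le_succ huY.2.le))
      obtain rfl | hlt := hmk.eq_or_lt
      · refine hgoal ⟨m, {u}, hm1, hmk, ⟨u, rfl⟩, ?_, fun h => absurd h h0,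
          .inl ⟨hcm, .inl rfl, ?_⟩⟩
        · rintro _ rfl
          exact huE
        · rintro _ rfl
          exact huY.2
      · refine hgoal ⟨m, insert u {w | G.El v w}, hm1, hmk, ⟨u, .inl rfl⟩, ?_, fun h => absurd h h0,
          .inr (.inl ⟨hcm, h0, fun w hw => .inr hw, u, .inl rfl, huY.2⟩)⟩
        rintro w (rfl | hw)
        · exact huE
        · exact ⟨G.live_edge v w hw, hX (m + 1) (by omega) hlt w (hlive hlt w hw)⟩
    -- In a bad row the live part of `apre` holds, so its other half must fail and some move leaves
    -- `Y_{2m}`. Maximality controls the live moves in row `m + 1`.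
    let bad : Set ℕ := {m | (1 ≤ m ∧ m ≤ k ∧ c v < 2 * m) ∧ ∃ w, G.El v w ∧ w ∈ W (2 * m - 1)}
    have hbadfin : bad.Finite := (Set.finite_Iic k).subset fun m hm => hm.1.2.1
    by_cases hne : bad.Nonempty
    · obtain ⟨m, ⟨⟨hm1, hmk, hcm⟩, w, hw, hwX⟩, hmax⟩ := Set.exists_max_image bad id hbadfin hne
      obtain ⟨u, hu, huW⟩ : ∃ u, G.E v u ∧ u ∉ W (2 * m) := by
        by_contra! h
        exact (hbody m hm1 hmk).2 hcm (.inr ⟨⟨w, hw, hwX⟩, h0, h⟩)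
      refine hdec m u hm1 hmk hcm.le hu huW fun hlt w hw hwX => ?_
      exact absurd (hmax (m + 1) ⟨⟨by omega, hlt, by omega⟩, w, hw, hwX⟩) (by simp)
    · have hlive : ∀ m, 1 ≤ m → m ≤ k → c v < 2 * m → ∀ w, G.El v w → w ∉ W (2 * m - 1) :=
        fun m hm1 hmk hcm w hw hwX => hne ⟨m, ⟨hm1, hmk, hcm⟩, w, hw, hwX⟩
      obtain hcj | hcj := hcj
      · obtain ⟨u, hu, huW⟩ := exists_succ_of_notMem_cpre ((hbody j hj1 hjk).1 hcj) h0
        exact hdec j u hj1 hjk hcj.le hu huW fun hlt => hlive (j + 1) (by omega) hlt (by omega)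
      · obtain ⟨u, hu, huW⟩ := exists_succ_of_notMem_cpre
          (fun h => (hbody j hj1 hjk).2 (by omega) (.inl h)) h0
        have hR : ∀ w ∈ insert u {w | G.El v w}, G.E v w ∧ w ∉ W (2 * j - 1) := by
          rintro w (rfl | hw)
          · exact ⟨hu, huW⟩
          · exact ⟨G.live_edge v w hw, hlive j hj1 hjk (by omega) w hw⟩
        refine hgoal ⟨j, insert u {w | G.El v w}, hj1, hjk, ⟨u, .inl rfl⟩, fun w hw => ?_,
          fun h => absurd h h0, .inr (.inr ⟨hcj, fun w hw => .inr hw, fun w hw => ?_⟩)⟩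
        · obtain ⟨h1, h2⟩ := hX j hj1 hjk w (hR w hw).2
          exact ⟨(hR w hw).1, h1, corankPrefix_le_of_le j.le_succ h2⟩
        · exact (hX j hj1 hjk w (hR w hw).2).2

theorem mem_parityFixpoint_of_winsFromWith [Finite V] (hE : ∀ v, ∃ w, G.E v w) {c : V → ℕ}
    (hc : IsColorMap k C c) {ρ₀ : List V → V → V} (hρ₀ : G.IsStrategy0 ρ₀) {v : V}
    (hwin : G.WinsFromWith (G.fairly (parityCondition k C)) ρ₀ v) :
    v ∈ G.parityFixpoint k C := by
  classical
  by_contra hv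
  choose! lev R hlev1 hlevk hRne hR hR0 hlev using
    fun v (hv : v ∉ G.parityFixpoint k C) => exists_moves_of_notMem hE hc hv
  choose! e heR he using fun v (hv : v ∉ G.parityFixpoint k C) => exists_rotation (hRne v hv)
  choose next hnext using hE
  let ρ₁ : List V → V → V := fun h v =>
    if v ∈ G.parityFixpoint k C then next v else e v (h.count v)
  have hρ₁ : G.IsStrategy1 ρ₁ := by
    intro h v _
    by_cases hv : v ∈ G.parityFixpoint k C
    · simp only [ρ₁, if_pos hv]
      exact hnext v
    · simp only [ρ₁, if_neg hv]
      exact (hR v hv _ (heR v hv _)).1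
  obtain ⟨π, hπ0, hπ⟩ := G.exists_compliantPlay ρ₀ ρ₁ v
  have hmove : ∀ m, π m ∉ G.parityFixpoint k C → π (m + 1) ∈ R (π m) := by
    intro m hm
    by_cases h0 : π m ∈ G.V0
    · refine hR0 _ hm h0 _ ?_
      rw [(hπ m).1 h0]
      exact hρ₀ _ _ h0
    · rw [(hπ m).2 h0]
      simp only [ρ₁, if_neg hm]
      exact heR _ hm _
  have hZ : ∀ m, π m ∉ G.parityFixpoint k C := by
    intro m
    induction m with
    | zero => exact hπ0 ▸ hv
    | succ m ih => exact (hR _ ih _ (hmove m ih)).2.1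
  have hinfZ : ∀ v, InfOften π {v} → v ∉ G.parityFixpoint k C := by
    intro v hv
    obtain ⟨m, -, hm⟩ := hv 0
    exact hm ▸ hZ m
  have hrot : ∀ v, InfOften π {v} → v ∈ G.V1 → ∀ u ∈ R v,
      ∀ N, ∃ m ≥ N, π m = v ∧ π (m + 1) = u := by
    intro v hv h1 u hu
    refine rotation_infOften (e := e v) (fun i hi => ?_) hv (he v (hinfZ v hv) u hu)
    subst hi
    rw [(hπ i).2 h1]
    simp only [ρ₁, if_neg (hZ i)]
  -- If some vertex of the limit set has a smaller move, then its level is not maximal.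
  have hlimit : ∀ J, (∀ b, InfOften π {b} → lev b ≤ J) → ∀ b, InfOften π {b} → lev b = J →
      ¬ ∃ w, InfOften π {w} ∧ G.corankPrefix k C J w < G.corankPrefix k C J b := by
    rintro J hJ b hb hbJ ⟨w, hw, hlt⟩
    refine not_lt_of_infOften (fun b hb => ?_) hb hw hlt
    have hbZ := hinfZ b hb
    obtain h | rfl := (hJ b hb).lt_or_eq
    · left
      rintro m rfl
      exact corankPrefix_le_of_le h (hR _ hbZ _ (hmove m hbZ)).2.2
    · obtain ⟨-, -, h⟩ | ⟨-, h1, -, u, hu, h⟩ | ⟨-, -, h⟩ := hlev b hbZ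
      · obtain ⟨m, rfl, hm⟩ := hb.exists_succ
        exact .inr ⟨_, hm, h _ (hmove m hbZ)⟩
      · refine .inr ⟨u, fun N => ?_, h⟩
        obtain ⟨m, hm, -, hmu⟩ := hrot b hb h1 u hu N
        exact ⟨m + 1, by omega, hmu⟩
      · left
        rintro m rfl
        exact h _ (hmove m hbZ)
  obtain ⟨n, hn⟩ := exists_forall_ge_infOften π
  obtain ⟨a, ha, hmax⟩ := Set.exists_max_image {v | InfOften π {v}} lev (Set.toFinite _)
    ⟨π n, hn n le_rfl⟩
  have hodd : ∀ b, InfOften π {b} → lev b = lev a →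
      c b = 2 * lev b - 1 ∧ ∀ w, G.El b w → w ∈ R b := by
    intro b hb hba
    have hnot := hba ▸ hlimit (lev a) hmax b hb hba
    obtain ⟨-, -, h⟩ | ⟨-, h1, -, u, hu, h⟩ | ⟨h, hEl, -⟩ := hlev b (hinfZ b hb)
    · obtain ⟨m, rfl, hm⟩ := hb.exists_succ
      exact absurd ⟨_, hm, h _ (hmove m (hZ m))⟩ hnot
    · refine absurd ⟨u, fun N => ?_, h⟩ hnot
      obtain ⟨m, hm, -, hmu⟩ := hrot b hb h1 u hu N
      exact ⟨m + 1, by omega, hmu⟩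
    · exact ⟨h, hEl⟩
  have haZ := hinfZ a ha
  -- Live moves are missing from `R b` at most at level `k`; if `b` recurs, that level is maximal
  -- and `hodd` supplies them after all.
  have hfair : π ∈ G.fairPlays := by
    intro b w hbw hb
    have h1 := G.live_owner b w hbw
    have hbZ := hinfZ b hb
    refine hrot b hb h1 w ?_
    obtain ⟨-, h | h, -⟩ | ⟨-, -, h, -⟩ | ⟨-, h, -⟩ := hlev b hbZ
    · refine (hodd b hb (le_antisymm (hmax b hb) ?_)).2 w hbw
      exact (hlevk a haZ).trans h.ge
    · exact absurd h h1
    · exact h w hbw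
    · exact h w hbw
  have ha1 := hlev1 a haZ
  have hak := hlevk a haZ
  have hinf : InfOften π (C (2 * lev a - 1)) := by
    intro N
    obtain ⟨m, hm, rfl⟩ := ha N
    exact ⟨m, hm, (hc.2 _ _ (by omega) (by omega)).2 (hodd _ ha rfl).1⟩
  obtain ⟨j, ⟨hj1, hjk⟩, hj⟩ := hwin ρ₁ hρ₁ π ⟨hπ0, hπ⟩ hfair (lev a) ⟨ha1, hak⟩ hinf
  obtain ⟨b, hbC, hb⟩ := hj.exists_mem
  have hcb := (hc.2 b _ (by omega) (by omega)).1 hbC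
  have hbm := hmax b hb
  have hb1 := hlev1 b (hinfZ b hb)
  -- A color never exceeds twice the level, so a recurring even color `2 * j` with `j ≥ lev a`
  -- forces the maximal level, where `hodd` makes colors odd.
  have hle : lev a ≤ lev b := by
    obtain ⟨h, -⟩ | ⟨h, -⟩ | ⟨h, -⟩ := hlev b (hinfZ b hb) <;> omega
  have := (hodd b hb (le_antisymm hbm hle)).1
  omega

end LiveGame

theorem mainTheorem4 :
    ∃ c : ℕ, ∀ (V : Type*) [Finite V] [Nonempty V] (G : LiveGame V),
      (∀ v, ∃ w, G.E v w) →
      ∀ (k : ℕ) (C : ℕ → Set V), IsParityColoring k C →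
        G.parityFixpoint k C = G.winningRegion (G.fairly (parityCondition k C)) ∧
        G.parityOutput k C = G.parityFixpoint k C ∧
        G.paritySteps k C ≤ c * k ^ 2 * Nat.card V ^ (k + 1) ∧
        ∃ ρ, G.IsStrategy0 ρ ∧ G.IsMemoryless0 ρ ∧ G.IsRankMinimizing k C ρ ∧
          ∀ v ∈ G.parityFixpoint k C, G.WinsFromWith (G.fairly (parityCondition k C)) ρ v := by
  refine ⟨46, fun V _ _ G hE k C hC => ?_⟩
  obtain ⟨c, hc⟩ := hC.exists_colorMap
  obtain ⟨ρ, hρ, hmem, hmin⟩ := LiveGame.exists_isRankMinimizing (G := G) hE hc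
  -- With `k = 0` there are no classes to cover the nonempty vertex set.
  have hk : 1 ≤ k := by
    obtain ⟨v⟩ := ‹Nonempty V›
    have := hc.1 v
    omega
  have hwin := fun v => LiveGame.winsFromWith_of_isRankMinimizing (v := v) hc hmin
  refine ⟨Set.Subset.antisymm (fun v hv => ⟨ρ, hρ, hwin v hv⟩) ?_, G.parityOutput_eq k C,
    G.paritySteps_le k C hk, ρ, hρ, hmem, hmin, hwin⟩
  rintro v ⟨ρ₀, hρ₀, hv⟩
  exact LiveGame.mem_parityFixpoint_of_winsFromWith hE hc hρ₀ hv
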